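/- Let $GL_3=GL(\mathbb{C}^3)$ act naturally on $(\mathbb{C}^3)^*\otimes S_{(2,1)}(\mathbb{C}^3)^*\otimes S_{(2,2)}\mathbb{C}^3$, where $S_\lambda$ denotes the Schur functor of the partition $\lambda$. The three factors have dimensions $3$, $8$ and $6$, so this space is isomorphic to $\mathbb{C}^3\otimes\mathbb{C}^8\otimes\mathbb{C}^6$. The subspace of $GL_3$-invariant tensors is one-dimensional, so there is a nonzero $GL_3$-invariant tensor $T$, unique up to scalar multiples. The border rank of a tensor is the smallest $r$ such that the tensor is a limit of sums of $r$ tensors of the form $a\otimes b\otimes c$. Then $T$ has border rank $10$, and this is the maximal border rank in the space: every tensor in $(\mathbb{C}^3)^*\otimes S_{(2,1)}(\mathbb{C}^3)^*\otimes S_{(2,2)}\mathbb{C}^3$ has border rank at most $10$. -/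

import Mathlib

open scoped TensorProduct

noncomputable section

/-- The row group of a Young diagram: the permutations of its cells that preserve every row. -/
def rowGroup (lam : YoungDiagram) : Finset (Equiv.Perm lam.cells) :=
  Finset.univ.filter fun p => ∀ x, (p x).1.1 = x.1.1

/-- The column group of a Young diagram: the permutations of its cells that preserve every
column. -/
def colGroup (lam : YoungDiagram) : Finset (Equiv.Perm lam.cells) :=
  Finset.univ.filter fun q => ∀ x, (q x).1.2 = x.1.2

/-- The tensor power `V ⊗ ⋯ ⊗ V`, with one factor for each cell of the Young diagram `lam`. -/
abbrev CellTensor (lam : YoungDiagram) (V : Type*) [AddCommGroup V] [Module ℂ V] : Type _ :=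
  PiTensorProduct ℂ (fun _ : lam.cells => V)

/-- The Young symmetrizer acting on the tensor power `V ⊗ ⋯ ⊗ V` by permuting the factors:
symmetrize along the rows, then antisymmetrize along the columns. -/
def youngSymmetrizer (lam : YoungDiagram) (V : Type*) [AddCommGroup V] [Module ℂ V] :
    CellTensor lam V →ₗ[ℂ] CellTensor lam V :=
  (∑ q ∈ colGroup lam, ((Equiv.Perm.sign q : ℤ) : ℂ) •
      (PiTensorProduct.reindex ℂ (fun _ : lam.cells => V) q).toLinearMap) ∘ₗ
    (∑ p ∈ rowGroup lam, (PiTensorProduct.reindex ℂ (fun _ : lam.cells => V) p).toLinearMap)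

/-- The Schur module `S_lam V`, as the image of the Young symmetrizer on the tensor power. -/
abbrev SchurModule (lam : YoungDiagram) (V : Type*) [AddCommGroup V] [Module ℂ V] : Type _ :=
  LinearMap.range (youngSymmetrizer lam V)

theorem youngSymmetrizer_comp_map (lam : YoungDiagram) {V W : Type*} [AddCommGroup V] [Module ℂ V]
    [AddCommGroup W] [Module ℂ W] (f : V →ₗ[ℂ] W) :
    youngSymmetrizer lam W ∘ₗ PiTensorProduct.map (fun _ => f) =
      PiTensorProduct.map (fun _ => f) ∘ₗ youngSymmetrizer lam V := by
  ext x
  simp [youngSymmetrizer, map_sum, PiTensorProduct.map_tprod, PiTensorProduct.reindex_tprod]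

theorem map_mem_range_youngSymmetrizer (lam : YoungDiagram) {V : Type*} [AddCommGroup V]
    [Module ℂ V] (f : V →ₗ[ℂ] V) (x : CellTensor lam V)
    (hx : x ∈ LinearMap.range (youngSymmetrizer lam V)) :
    PiTensorProduct.map (fun _ => f) x ∈ LinearMap.range (youngSymmetrizer lam V) := by
  obtain ⟨y, rfl⟩ := hx
  exact ⟨PiTensorProduct.map (fun _ => f) y,
    LinearMap.congr_fun (youngSymmetrizer_comp_map lam f) y⟩

/-- The representation of `G` on `S_lam V` induced by a representation of `G` on `V`:
the restriction of `g ⊗ ⋯ ⊗ g`. -/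
def schurRep (lam : YoungDiagram) {G V : Type*} [Monoid G] [AddCommGroup V] [Module ℂ V]
    (rho : Representation ℂ G V) : Representation ℂ G (SchurModule lam V) where
  toFun g := (PiTensorProduct.map (fun _ => rho g)).restrict
    (map_mem_range_youngSymmetrizer lam (rho g))
  map_one' := by
    ext x : 2
    simp only [map_one, PiTensorProduct.map_one]
    rfl
  map_mul' g h := by
    ext x : 2
    simp only [map_mul, PiTensorProduct.map_mul]
    rfl

/-- The partition `(2,1)`. -/
def shape21 : YoungDiagram := YoungDiagram.ofRowLens [2, 1] (by decide)

/-- The partition `(2,2)`. -/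
def shape22 : YoungDiagram := YoungDiagram.ofRowLens [2, 2] (by decide)

/-- The vector space `ℂ³`. -/
abbrev C3 : Type := Fin 3 → ℂ

/-- The group `GL_3` of invertible linear maps of `ℂ³`. -/
abbrev GL3 : Type := LinearMap.GeneralLinearGroup ℂ C3

/-- The standard representation of `GL_3` on `ℂ³`. -/
def stdRep : Representation ℂ GL3 C3 := Units.coeHom (C3 →ₗ[ℂ] C3)

/-- The space `(ℂ³)* ⊗ S_{(2,1)}(ℂ³)* ⊗ S_{(2,2)}ℂ³`. -/
abbrev TensorSpace : Type :=
  Module.Dual ℂ C3 ⊗[ℂ] (SchurModule shape21 (Module.Dual ℂ C3) ⊗[ℂ] SchurModule shape22 C3)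

/-- The natural representation of `GL_3` on `(ℂ³)* ⊗ S_{(2,1)}(ℂ³)* ⊗ S_{(2,2)}ℂ³`. -/
def tensorRep : Representation ℂ GL3 TensorSpace :=
  stdRep.dual.tprod ((schurRep shape21 stdRep.dual).tprod (schurRep shape22 stdRep))

section BorderRank

variable (A B C : Type*) [AddCommGroup A] [Module ℂ A] [AddCommGroup B] [Module ℂ B]
  [AddCommGroup C] [Module ℂ C]

/-- The tensors in `A ⊗ B ⊗ C` that are sums of `r` tensors of the form `a ⊗ b ⊗ c`
(some of which may vanish, so these are the tensors of rank at most `r`). -/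
def rankLE (r : ℕ) : Set (A ⊗[ℂ] (B ⊗[ℂ] C)) :=
  {T | ∃ (a : Fin r → A) (b : Fin r → B) (c : Fin r → C), T = ∑ i, a i ⊗ₜ[ℂ] (b i ⊗ₜ[ℂ] c i)}

/-- The limits of tensors of rank at most `r`. The topology is the module topology, which on a
finite-dimensional complex vector space is the usual (Euclidean) topology. -/
def borderRankLE (r : ℕ) : Set (A ⊗[ℂ] (B ⊗[ℂ] C)) :=
  @closure _ (moduleTopology ℂ (A ⊗[ℂ] (B ⊗[ℂ] C))) (rankLE A B C r)

variable {A B C}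

/-- The border rank of `T`: the smallest `r` such that `T` is a limit of tensors of rank at
most `r`. (Every tensor is a finite sum of tensors `a ⊗ b ⊗ c`, so such an `r` exists.) -/
def borderRank (T : A ⊗[ℂ] (B ⊗[ℂ] C)) : ℕ :=
  sInf {r : ℕ | T ∈ borderRankLE A B C r}

end BorderRank

end

/-! Write V = ℂ³. Up to powers of the determinant, S₍₂,₁₎V* is the space of traceless 3×3 matrices
and S₍₂,₂₎V the space of symmetric ones. In these coordinates the invariant is built from a
Kronecker delta and the Levi-Civita symbol (`invariantCoord`).

Upper bound. The derivative of the map summing ten decomposable tensors is surjective at an explicit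
point (`eq_zero_of_vanish_on_tangents`). A polynomial map with this property has an image containing
the nonvanishing locus of a nonzero polynomial, which is dense in the Euclidean topology
(`MvPolynomial.denseRange_of_surjective_fderiv`).

Lower bound, by border apolarity. Suppose sums of nine terms a_r ⊗ b_r ⊗ c_r tend to T. Let J, I, K
be the limits of the spaces of forms of bidegree (1,1), (1,2), (0,2) vanishing at the points (a_r,
c_r). Counting conditions gives dim J ≥ 9 and dim K ≥ 12. Forms in J annihilate T, so J lies in the
ten-dimensional space S³V inside V ⊗ S²V. Hilbert functions of points do not decrease, hence dim I ≤
45 + dim J. There are no linear syzygies among cubics (`eq_zero_of_prolong_eq_zero`), so the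
products of J with the six coordinates have dimension 6 dim J and lie in I. Therefore dim J = 9 and
these products fill I.

The products V · K also lie in I, and so come from J. This forces every element of K to be a quartic
(`quartic_of_prolong`). A cubic operator killing J makes these quartics apolar to its derivatives
(`apolar_of_prolong`), one of which is a nonzero quadric. Quartics apolar to a nonzero quadric form
a space of dimension at most 15 - 6 = 9, contradicting dim K ≥ 12. -/

noncomputable section

/-! ### Dominant polynomial maps have dense image in the Euclidean topology -/

section Dominant

open MvPolynomial

/-- The values of a polynomial that does not vanish identically are dense-open: its nonvanishing
locus is dense. -/
theorem MvPolynomial.dense_eval_ne_zero {τ : Type*} [Finite τ] {P : MvPolynomial τ ℂ}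
    (hP : P ≠ 0) : Dense {y : τ → ℂ | eval y P ≠ 0} := by
  have := Fintype.ofFinite τ
  rw [dense_iff_inter_open]
  intro U hU ⟨y, hy⟩
  by_contra hne
  obtain ⟨ε, hε, hball⟩ := Metric.isOpen_iff.1 hU y hy
  refine hP (funext_set (fun i => Metric.ball (y i) ε) (fun i => ?_) fun x hx => ?_)
  · exact infinite_of_mem_nhds (y i) (Metric.ball_mem_nhds _ hε)
  · rw [map_zero]
    by_contra hx0
    refine hne ⟨x, hball ?_, hx0⟩
    rw [← ball_pi _ hε] at hx
    exact hx

/-- An algebraic relation would vanish on the whole image, hence on a neighbourhood, while the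
nonvanishing locus of a nonzero polynomial is dense and meets it. -/
theorem MvPolynomial.algebraicIndependent_of_nhds {σ τ : Type*} [Finite τ]
    (f : τ → MvPolynomial σ ℂ) (y : τ → ℂ)
    (h : Set.range (fun (x : σ → ℂ) j => eval x (f j)) ∈ nhds y) :
    AlgebraicIndependent ℂ f := by
  rw [algebraicIndependent_iff]
  intro P hP
  by_contra hP0
  have := Fintype.ofFinite τ
  obtain ⟨_, hy, x, rfl⟩ := (mem_closure_iff_nhds.1 (dense_eval_ne_zero hP0 y)) _ h |>.imp
    fun z hz => And.symm hz
  refine hy ?_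
  have := congrArg (eval x) hP
  rw [map_zero] at this
  rw [← this, aeval_def, eval₂_eq', map_sum, eval_eq']
  simp [map_prod, algebraMap_eq]

/-- If `1` lies in the extension of a maximal ideal and a multiplier `D` makes the coefficients
integral, then `D` lies in the maximal ideal. -/
theorem Ideal.mem_of_one_eq_sum_of_isIntegral_pow_smul {ι S R : Type*} [Fintype ι] [CommRing S]
    [CommRing R] [Algebra S R] (hinj : Function.Injective (algebraMap S R)) (m : Ideal S)
    [m.IsMaximal] (D : S) (c : ι → R) (s : ι → S) (hs : ∀ j, s j ∈ m)
    (hone : ∑ j, c j * algebraMap S R (s j) = 1)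
    (hint : ∀ j, ∃ n : ℕ, IsIntegral S (D ^ n • c j)) : D ∈ m := by
  -- Lying over: a prime of the integral closure above `m`. After multiplication by a power of `D`,
  -- the relation `hone` takes place in the integral closure and puts that power in `Q`.
  obtain ⟨Q, hQ, hQS⟩ := Ideal.exists_ideal_over_maximal_of_isIntegral
    (S := integralClosure S R) m (by
      have : Function.Injective (algebraMap S (integralClosure S R)) := fun x y h =>
        hinj (congrArg Subtype.val h)
      rw [(RingHom.injective_iff_ker_eq_bot _).1 this]
      exact bot_le)
  choose n hn using hint
  let N := ∑ j, n j
  have hN : ∀ j, IsIntegral S (D ^ N • c j) := fun j => by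
    have : N = (N - n j) + n j :=
      (Nat.sub_add_cancel (Finset.single_le_sum (f := n) (fun _ _ => Nat.zero_le _)
        (Finset.mem_univ j))).symm
    rw [this, pow_add, mul_smul]
    exact (hn j).smul _
  have hmem : algebraMap S (integralClosure S R) (D ^ N) =
      ∑ j, (⟨D ^ N • c j, hN j⟩ : integralClosure S R) * algebraMap S _ (s j) := by
    apply Subtype.ext
    have h2 : ((algebraMap S (integralClosure S R) (D ^ N) : integralClosure S R) : R) =
        D ^ N • (1 : R) := by
      rw [Algebra.smul_def, mul_one]
      rfl
    rw [h2, ← hone, Finset.smul_sum, AddSubmonoidClass.coe_finsetSum]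
    refine Finset.sum_congr rfl fun j _ => ?_
    rw [← smul_mul_assoc]
    rfl
  have hDQ : D ^ N ∈ m := by
    rw [← hQS, Ideal.mem_comap, hmem]
    refine Ideal.sum_mem _ fun j _ => Ideal.mul_mem_left _ _ ?_
    rw [← Ideal.mem_comap, hQS]
    exact hs j
  exact (inferInstance : m.IsPrime).mem_of_pow_mem _ hDQ

/-- If polynomials are integral after multiplication by `D`, then so is everything that they
generate, up to a power of `D`. -/
theorem MvPolynomial.exists_isIntegral_pow_smul {σ S : Type*} [CommRing S] [Algebra ℂ S]
    [Algebra S (MvPolynomial σ ℂ)] [IsScalarTower ℂ S (MvPolynomial σ ℂ)] (D : S)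
    (hD : ∀ i, IsIntegral S (D • (X i : MvPolynomial σ ℂ))) (h : MvPolynomial σ ℂ) :
    ∃ n : ℕ, IsIntegral S (D ^ n • h) := by
  induction h using MvPolynomial.induction_on with
  | C a =>
    refine ⟨0, ?_⟩
    rw [pow_zero, one_smul, ← algebraMap_eq, IsScalarTower.algebraMap_apply ℂ S]
    exact isIntegral_algebraMap
  | add p q hp hq =>
    obtain ⟨m, hm⟩ := hp
    obtain ⟨n, hn⟩ := hq
    refine ⟨m + n, ?_⟩
    rw [smul_add]
    refine IsIntegral.add ?_ ?_
    · rw [pow_add, mul_comm, mul_smul]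
      exact hm.smul _
    · rw [pow_add, mul_smul]
      exact hn.smul _
  | mul_X p i hp =>
    obtain ⟨m, hm⟩ := hp
    refine ⟨m + 1, ?_⟩
    have := hm.mul (hD i)
    rwa [smul_mul_smul_comm, ← pow_succ] at this

/-- As many independent polynomials as variables form a transcendence basis, so one nonzero `D` in
ℂ[f] makes every `D • X i` integral over ℂ[f]. By the Nullstellensatz an empty fibre over y puts 1
in the ideal of the `f j - y j`, and lying over then gives D(y) = 0. The polynomial `P` is `D`
written in the `f j`. -/
theorem AlgebraicIndependent.exists_eval_eq {σ : Type} [Finite σ] {f : σ → MvPolynomial σ ℂ}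
    (hf : AlgebraicIndependent ℂ f) :
    ∃ P : MvPolynomial σ ℂ, P ≠ 0 ∧ ∀ y, eval y P ≠ 0 → ∃ x, ∀ j, eval x (f j) = y j := by
  have := Fintype.ofFinite σ
  have hb : IsTranscendenceBasis ℂ f :=
    hf.isTranscendenceBasis_of_trdeg_le_of_finite (by simp [MvPolynomial.trdeg_of_isDomain])
  have halg := hb.isAlgebraic
  obtain ⟨D, hD, hDint⟩ := Algebra.IsAlgebraic.exists_integral_multiples
    (Algebra.adjoin ℂ (Set.range f)) (Finset.univ.image (X : σ → MvPolynomial σ ℂ))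
  refine ⟨hf.aevalEquiv.symm D, by simpa using hD, fun y hy => ?_⟩
  by_contra hne
  push Not at hne
  let I : Ideal (MvPolynomial σ ℂ) := Ideal.span (Set.range fun j => f j - C (y j))
  have hI : I = ⊤ := by
    rw [← Ideal.radical_eq_top, ← vanishingIdeal_zeroLocus_eq_radical (K := ℂ)]
    have : zeroLocus ℂ I = ∅ := by
      ext x
      simp only [I, zeroLocus_span, Set.mem_ofPred_eq, Set.mem_empty_iff_false, iff_false]
      intro h
      obtain ⟨j, hj⟩ := hne x
      have := h _ ⟨j, rfl⟩
      exact hj (by simpa [sub_eq_zero] using this)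
    rw [this, vanishingIdeal_empty]
  let ev : Algebra.adjoin ℂ (Set.range f) →ₐ[ℂ] ℂ :=
    (aeval y).comp hf.aevalEquiv.symm.toAlgHom
  have hev : Function.Surjective ev := fun c => ⟨algebraMap ℂ _ c, by simp⟩
  have : (RingHom.ker ev).IsMaximal := RingHom.ker_isMaximal_of_surjective ev hev
  have hone : (1 : MvPolynomial σ ℂ) ∈ I := hI ▸ Submodule.mem_top
  obtain ⟨c, hc⟩ := (Submodule.mem_span_range_iff_exists_fun _).1 hone
  let s : σ → Algebra.adjoin ℂ (Set.range f) := fun j => ⟨f j, Algebra.subset_adjoin ⟨j, rfl⟩⟩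
  have hfs : ∀ j, ev (s j) = y j := fun j => by
    have : hf.aevalEquiv.symm (s j) = X j := by
      rw [AlgEquiv.symm_apply_eq]
      apply Subtype.ext
      simp [s]
    change aeval y (hf.aevalEquiv.symm (s j)) = _
    rw [this, aeval_X]
  refine hy (Ideal.mem_of_one_eq_sum_of_isIntegral_pow_smul Subtype.val_injective
    (RingHom.ker ev) D c (fun j => s j - algebraMap ℂ _ (y j)) (fun j => ?_) ?_ fun j => ?_)
  · rw [RingHom.mem_ker, map_sub, hfs, AlgHom.commutes]
    exact sub_self _
  · exact hc
  · exact exists_isIntegral_pow_smul D (fun i => hDint _ (by simp)) _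

/-- A map with surjective strict derivative covers a neighbourhood already on an affine slice of
complementary dimension. -/
theorem HasStrictFDerivAt.exists_slice_range_mem_nhds {E F : Type*} [NormedAddCommGroup E]
    [NormedSpace ℂ E] [CompleteSpace E] [NormedAddCommGroup F] [NormedSpace ℂ F]
    [FiniteDimensional ℂ F] {g : E → F} {g' : E →L[ℂ] F} {x₀ : E}
    (hg : HasStrictFDerivAt g g' x₀) (hsurj : Function.Surjective g') :
    ∃ L : F →ₗ[ℂ] E, Set.range (fun z => g (x₀ + L z)) ∈ nhds (g x₀) := by
  obtain ⟨L, hL⟩ := g'.toLinearMap.exists_rightInverse_of_surjective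
    (LinearMap.range_eq_top.2 hsurj)
  have := FiniteDimensional.complete ℂ F
  let Lc : F →L[ℂ] E := LinearMap.toContinuousLinearMap L
  have h1 : HasStrictFDerivAt (fun z : F => x₀ + Lc z) Lc 0 :=
    Lc.hasStrictFDerivAt.const_add x₀
  have h2 : HasStrictFDerivAt g g' (x₀ + Lc 0) := by
    rwa [map_zero, add_zero]
  have h3 : HasStrictFDerivAt (fun z => g (x₀ + Lc z)) (g'.comp Lc) 0 := h2.comp 0 h1
  have h4 := h3.map_nhds_eq_of_surj (LinearMap.range_eq_top.2 fun w =>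
    ⟨w, LinearMap.congr_fun hL w⟩)
  rw [map_zero, add_zero] at h4
  exact ⟨L, h4 ▸ Filter.range_mem_map⟩

/-- A polynomial map with surjective derivative at some point has dense range. -/
theorem MvPolynomial.denseRange_of_surjective_fderiv {σ τ : Type} [Fintype σ] [Fintype τ]
    (p : τ → MvPolynomial σ ℂ) (g : (σ → ℂ) → (τ → ℂ)) (hg : ∀ x j, g x j = eval x (p j))
    {x₀ : σ → ℂ} {g' : (σ → ℂ) →L[ℂ] (τ → ℂ)} (hF : HasStrictFDerivAt g g' x₀)
    (hsurj : Function.Surjective g') : DenseRange g := by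
  classical
  obtain ⟨L, hL⟩ := hF.exists_slice_range_mem_nhds hsurj
  -- Parametrization of the slice by affine polynomials. It leaves as many variables as components,
  -- which is what `AlgebraicIndependent.exists_eval_eq` requires.
  let q : σ → MvPolynomial τ ℂ := fun i => C (x₀ i) + ∑ j, C (L (Pi.single j 1) i) * X j
  have hq : ∀ z i, eval z (q i) = x₀ i + L z i := fun z i => by
    have : L z = ∑ j, z j • L (Pi.single j 1) := by
      conv_lhs => rw [← Finset.univ_sum_single z, map_sum]
      refine Finset.sum_congr rfl fun j _ => ?_
      rw [← map_smul, ← Pi.single_smul, smul_eq_mul, mul_one]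
    simp [q, this, mul_comm]
  let f : τ → MvPolynomial τ ℂ := fun j => bind₁ q (p j)
  have hfe : ∀ z, (fun j => eval z (f j)) = g (x₀ + L z) := fun z => by
    funext j
    have hx : (fun i => eval z (q i)) = x₀ + L z := by
      funext i
      exact hq z i
    rw [hg, ← hx]
    exact eval₂Hom_bind₁ (RingHom.id ℂ) z q (p j)
  simp only [← hfe] at hL
  obtain ⟨P, hP, hPf⟩ := (algebraicIndependent_of_nhds f _ hL).exists_eval_eq
  refine (dense_eval_ne_zero hP).mono fun y hy => ?_
  obtain ⟨z, hz⟩ := hPf y hy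
  refine ⟨x₀ + L z, ?_⟩
  rw [← hfe]
  funext j
  exact hz j

end Dominant
end

noncomputable section

/-! ### Sums of ten decomposable tensors are dense in ℂ³ ⊗ ℂ⁸ ⊗ ℂ⁶ -/

section Generic

/-- First factors of ten triples in `ℂ³ × ℂ⁸ × ℂ⁶` at which the sums of ten decomposable tensors
have surjective derivative. -/
def pointA : Fin 10 → Fin 3 → ℕ :=
  ![![0, 0, 1], ![0, 1, 0], ![1, 0, 0], ![1, 0, 0], ![1, 1, 1], ![0, 1, 1], ![0, 0, 1], ![1, 0, 1],
    ![1, 1, 0], ![0, 1, 0]]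

/-- Second factors of the ten triples. -/
def pointB : Fin 10 → Fin 8 → ℕ :=
  ![![1, 0, 0, 0, 0, 0, 0, 0], ![0, 1, 0, 0, 0, 0, 0, 0], ![0, 0, 1, 0, 0, 0, 0, 0],
    ![0, 0, 0, 1, 0, 0, 0, 0], ![0, 0, 0, 0, 1, 0, 0, 0], ![0, 0, 0, 0, 0, 1, 0, 0],
    ![0, 0, 0, 0, 0, 0, 1, 0], ![0, 0, 0, 0, 0, 0, 0, 1], ![0, 1, 1, 1, 0, 0, 1, 1],
    ![1, 1, 1, 0, 1, 1, 0, 1]]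

/-- Third factors of the ten triples. -/
def pointC : Fin 10 → Fin 6 → ℕ :=
  ![![1, 0, 0, 0, 0, 0], ![0, 1, 0, 0, 0, 0], ![0, 0, 1, 0, 0, 0], ![0, 0, 0, 1, 0, 0],
    ![0, 0, 0, 0, 1, 0], ![0, 0, 0, 0, 0, 1], ![1, 0, 1, 1, 0, 1], ![1, 0, 0, 1, 1, 0],
    ![1, 1, 0, 0, 0, 0], ![0, 1, 1, 0, 0, 1]]

set_option maxHeartbeats 4000000 in
/-- The tangent spaces to the decomposable tensors at the ten points span `ℂ³ ⊗ ℂ⁸ ⊗ ℂ⁶`: a form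
vanishing on all of them is zero. -/
theorem eq_zero_of_vanish_on_tangents (f : Fin 3 → Fin 8 → Fin 6 → ℂ)
    (hA : ∀ r i, ∑ j, ∑ k, f i j k * (pointB r j * pointC r k) = 0)
    (hB : ∀ r j, ∑ i, ∑ k, f i j k * (pointA r i * pointC r k) = 0)
    (hC : ∀ r k, ∑ i, ∑ j, f i j k * (pointA r i * pointB r j) = 0) : ∀ i j k, f i j k = 0 := by
  simp only [Fin.forall_fin_succ, Fin.sum_univ_succ, pointA, pointB, pointC,
    Matrix.cons_val_zero, Matrix.cons_val_succ, Finset.univ_eq_empty, Finset.sum_empty,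
    Nat.cast_zero, Nat.cast_one, mul_zero, mul_one, add_zero, zero_add,
    IsEmpty.forall_iff, and_true] at hA hB hC
  casesm* _ ∧ _
  simp only [Fin.forall_fin_succ, IsEmpty.forall_iff, and_true]
  -- The points have entries 0 and 1, and the 170 equations in 144 unknowns are solved by
  -- substituting them into each other and dropping zeros, without division.
  simp_all only [add_zero, zero_add, and_self]

open MvPolynomial in
/-- The sums of ten decomposable tensors are dense in `ℂ³ ⊗ ℂ⁸ ⊗ ℂ⁶`, in coordinates. -/
theorem denseRange_sum_ten_decomposable :
    DenseRange fun (x : (Fin 10 × Fin 3) ⊕ (Fin 10 × Fin 8) ⊕ (Fin 10 × Fin 6) → ℂ)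
      (t : Fin 3 × Fin 8 × Fin 6) =>
      ∑ r, x (.inl (r, t.1)) * (x (.inr (.inl (r, t.2.1))) * x (.inr (.inr (r, t.2.2)))) := by
  let x₀ : (Fin 10 × Fin 3) ⊕ (Fin 10 × Fin 8) ⊕ (Fin 10 × Fin 6) → ℂ :=
    Sum.elim (fun p => pointA p.1 p.2)
      (Sum.elim (fun p => pointB p.1 p.2) (fun p => pointC p.1 p.2))
  let π := fun i => ContinuousLinearMap.proj (R := ℂ)
    (φ := fun _ : (Fin 10 × Fin 3) ⊕ (Fin 10 × Fin 8) ⊕ (Fin 10 × Fin 6) => ℂ) i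
  let g' : ((Fin 10 × Fin 3) ⊕ (Fin 10 × Fin 8) ⊕ (Fin 10 × Fin 6) → ℂ) →L[ℂ]
      (Fin 3 × Fin 8 × Fin 6 → ℂ) := ContinuousLinearMap.pi fun t => ∑ r,
    (x₀ (.inl (r, t.1)) • (x₀ (.inr (.inl (r, t.2.1))) • π (.inr (.inr (r, t.2.2))) +
      x₀ (.inr (.inr (r, t.2.2))) • π (.inr (.inl (r, t.2.1)))) +
      (x₀ (.inr (.inl (r, t.2.1))) * x₀ (.inr (.inr (r, t.2.2)))) • π (.inl (r, t.1)))
  refine denseRange_of_surjective_fderiv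
    (p := fun t => ∑ r, X (.inl (r, t.1)) * (X (.inr (.inl (r, t.2.1))) *
      X (.inr (.inr (r, t.2.2))))) _ (fun x t => by simp) (x₀ := x₀) (g' := g') ?_ ?_
  · rw [hasStrictFDerivAt_pi']
    intro t
    have hp : ∀ i, HasStrictFDerivAt
        (fun x : (Fin 10 × Fin 3) ⊕ (Fin 10 × Fin 8) ⊕ (Fin 10 × Fin 6) → ℂ => x i) (π i) x₀ :=
      fun i => (π i).hasStrictFDerivAt
    exact HasStrictFDerivAt.fun_sum (u := Finset.univ) fun r _ =>
      (hp (.inl (r, t.1))).mul ((hp (.inr (.inl (r, t.2.1)))).mul (hp (.inr (.inr (r, t.2.2)))))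
  · rw [← ContinuousLinearMap.coe_coe, ← LinearMap.range_eq_top]
    -- If the derivative were not surjective, a nonzero functional would vanish on its range, that
    -- is, on all the tangent spaces.
    by_contra hne
    obtain ⟨φ, hφ, hle⟩ := Submodule.exists_le_ker_of_lt_top _ (lt_top_iff_ne_top.2 hne)
    have hφ0 : ∀ w, φ w = ∑ i, ∑ j, ∑ k, φ (Pi.single (i, j, k) 1) * w (i, j, k) := fun w => by
      conv_lhs => rw [← Finset.univ_sum_single w, map_sum, Fintype.sum_prod_type]
      refine Finset.sum_congr rfl fun i _ => ?_
      rw [Fintype.sum_prod_type]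
      refine Finset.sum_congr rfl fun j _ => Finset.sum_congr rfl fun k _ => ?_
      rw [mul_comm, ← smul_eq_mul, ← map_smul, ← Pi.single_smul, smul_eq_mul, mul_one]
    have hv : ∀ v, ∑ i, ∑ j, ∑ k, φ (Pi.single (i, j, k) 1) * g' v (i, j, k) = 0 := fun v => by
      rw [← hφ0]
      exact hle ⟨v, rfl⟩
    have key := eq_zero_of_vanish_on_tangents (fun i j k => φ (Pi.single (i, j, k) 1)) ?_ ?_ ?_
    · refine hφ (LinearMap.ext fun w => ?_)
      rw [hφ0]
      simp [key]
    · intro r i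
      have := hv (Pi.single (.inl (r, i)) 1)
      rw [Finset.sum_eq_single i] at this
      · simpa [g', π, x₀, Pi.single_apply] using this
      · intro i' _ hi'
        simp [g', π, x₀, hi']
      · simp
    · intro r j
      have := hv (Pi.single (.inr (.inl (r, j))) 1)
      simp only [g', π, x₀, ContinuousLinearMap.pi_apply] at this
      simpa [Pi.single_apply, Prod.ext_iff, ite_and] using this
    · intro r k
      have := hv (Pi.single (.inr (.inr (r, k))) 1)
      simp only [g', π, x₀, ContinuousLinearMap.pi_apply] at this
      simpa [Pi.single_apply, Prod.ext_iff, ite_and] using this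

section Transfer

variable {A B C : Type} [AddCommGroup A] [Module ℂ A] [AddCommGroup B] [Module ℂ B]
  [AddCommGroup C] [Module ℂ C]

/-- Linear maps are continuous from the module topology to any topological vector space. -/
theorem LinearMap.continuous_moduleTopology {E F : Type*} [AddCommGroup E] [Module ℂ E]
    [AddCommGroup F] [Module ℂ F] [TopologicalSpace F] [ContinuousAdd F] [ContinuousSMul ℂ F]
    (f : E →ₗ[ℂ] F) : @Continuous _ _ (moduleTopology ℂ E) _ f := by
  let _ : TopologicalSpace E := moduleTopology ℂ E
  have : IsModuleTopology ℂ E := ⟨rfl⟩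
  exact IsModuleTopology.continuous_of_linearMap f

theorem borderRankLE_mono {r s : ℕ} (h : r ≤ s) : borderRankLE A B C r ⊆ borderRankLE A B C s := by
  refine @closure_mono _ (moduleTopology ℂ _) _ _ ?_
  obtain ⟨k, rfl⟩ := Nat.exists_eq_add_of_le h
  rintro _ ⟨a, b, c, rfl⟩
  refine ⟨Fin.append a 0, Fin.append b 0, Fin.append c 0, ?_⟩
  rw [Fin.sum_univ_add]
  simp

theorem borderRankLE_ten_eq_univ (hA : Module.finrank ℂ A = 3) (hB : Module.finrank ℂ B = 8)
    (hC : Module.finrank ℂ C = 6) : borderRankLE A B C 10 = Set.univ := by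
  have := Module.finite_of_finrank_pos (hA ▸ Nat.succ_pos 2 : 0 < Module.finrank ℂ A)
  have := Module.finite_of_finrank_pos (hB ▸ Nat.succ_pos 7 : 0 < Module.finrank ℂ B)
  have := Module.finite_of_finrank_pos (hC ▸ Nat.succ_pos 5 : 0 < Module.finrank ℂ C)
  let bA := Module.finBasisOfFinrankEq ℂ A hA
  let bB := Module.finBasisOfFinrankEq ℂ B hB
  let bC := Module.finBasisOfFinrankEq ℂ C hC
  let e := (bA.tensorProduct (bB.tensorProduct bC)).equivFun
  let _ : TopologicalSpace (A ⊗[ℂ] (B ⊗[ℂ] C)) := moduleTopology ℂ _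
  have hcont : Continuous e.symm := by
    have : IsModuleTopology ℂ (A ⊗[ℂ] (B ⊗[ℂ] C)) := ⟨rfl⟩
    have : ContinuousAdd (A ⊗[ℂ] (B ⊗[ℂ] C)) := IsModuleTopology.toContinuousAdd ℂ _
    exact LinearMap.continuous_on_pi e.symm.toLinearMap
  have hd := (e.symm.surjective.denseRange).comp denseRange_sum_ten_decomposable hcont
  rw [Set.eq_univ_iff_forall]
  intro T
  refine closure_mono ?_ (hd T)
  rintro _ ⟨x, rfl⟩
  refine ⟨fun r => bA.equivFun.symm fun i => x (.inl (r, i)),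
    fun r => bB.equivFun.symm fun j => x (.inr (.inl (r, j))),
    fun r => bC.equivFun.symm fun k => x (.inr (.inr (r, k))), ?_⟩
  simp only [Function.comp]
  rw [LinearEquiv.symm_apply_eq]
  funext t
  obtain ⟨i, j, k⟩ := t
  have hrA : ∀ v i, bA.repr (bA.equivFun.symm v) i = v i := fun v i =>
    congrFun (bA.equivFun.apply_symm_apply v) i
  have hrB : ∀ v i, bB.repr (bB.equivFun.symm v) i = v i := fun v i =>
    congrFun (bB.equivFun.apply_symm_apply v) i
  have hrC : ∀ v i, bC.repr (bC.equivFun.symm v) i = v i := fun v i =>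
    congrFun (bC.equivFun.apply_symm_apply v) i
  simp only [e, map_sum, Finset.sum_apply, Module.Basis.equivFun_apply,
    Module.Basis.tensorProduct_repr_tmul_apply, smul_eq_mul, hrA, hrB, hrC]
  exact Finset.sum_congr rfl fun r _ => by ring

end Transfer

end Generic
end

noncomputable section

/-! ### Index exchange identities, and quartics apolar to a quadric -/

section Syzygy

/-- The position of a pair of indices among the six unordered pairs of indices in `Fin 3`. -/
def pairIdx : Fin 3 → Fin 3 → Fin 6 := ![![0, 1, 2], ![1, 3, 4], ![2, 4, 5]]

theorem pairIdx_comm (i j : Fin 3) : pairIdx i j = pairIdx j i := by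
  fin_cases i <;> fin_cases j <;> rfl

theorem exists_pairIdx_eq (u : Fin 6) : ∃ i j, pairIdx i j = u := by
  revert u; decide

/-- A tensor symmetric in its first two and in its last three indices is determined by its
symmetrization under the exchange of the two first with the two last indices. -/
theorem two_mul_eq_of_add_swap_eq {ι : Type*} (g h : ι → ι → ι → ι → ι → ℂ)
    (g₁ : ∀ p q i r s, g p q i r s = g q p i r s) (g₂ : ∀ p q i r s, g p q i r s = g p q i s r)
    (g₃ : ∀ p q i r s, g p q i r s = g p q r i s)
    (gh : ∀ i p q r s, g p q i r s + g r s i p q = h i p q r s) (p q i r s : ι) :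
    2 * g p q i r s = 2 * h r p q i s - h p i s r q - h q i s r p + h s r q i p
      - h r i p s q + h i s q r p := by
  -- Modulo h, the relation `gh` exchanges the pairs pq and rs with a sign. Applied twice, with a
  -- regrouping by symmetry in between, it exchanges p and r without a sign. Modulo h, then, g is
  -- totally symmetric and equal to its own negative; keeping track of h gives the formula for 2g.
  have key : ∀ p q i r s, g p q i r s = h r p q i s - h p i s r q + g r q i s p := by
    intro p q i r s
    linear_combination g₃ p q i r s + gh r p q i s - g₃ i s r p q - gh p i s r q
      + g₃ r q p i s + g₂ r q i p s
  linear_combination key p q i r s + g₁ p q i r s + key q p i r s + key r q i s p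
    + g₂ s q i p r + gh i s q r p + gh r p q i s - gh r q p i s
    - g₁ p q r i s - g₂ i s r p q


/-! ### Apolarity of quartics to a quadric -/

variable {z : Fin 3 → Fin 3 → Fin 3 → Fin 3 → ℂ} {g : Fin 3 → Fin 3 → ℂ}

/-- A quartic apolar to a quadric with a nonzero square term `a²` vanishes as soon as its
coefficients at the monomials not divisible by `a²` vanish. -/
theorem quartic_eq_zero_of_diag {a b c : Fin 3} (hcov : ∀ i, i = a ∨ i = b ∨ i = c)
    (hsum : ∀ f : Fin 3 → ℂ, ∑ i, f i = f a + f b + f c)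
    (h₁ : ∀ p q r t, z p q r t = z q p r t) (h₂ : ∀ p q r t, z p q r t = z p r q t)
    (h₃ : ∀ p q r t, z p q r t = z p q t r) (hg : g a a ≠ 0)
    (hz : ∀ p q, ∑ r, ∑ t, g r t * z p q r t = 0)
    (e₁ : z a b b b = 0) (e₂ : z a b b c = 0) (e₃ : z a b c c = 0) (e₄ : z a c c c = 0)
    (e₅ : z b b b b = 0) (e₆ : z b b b c = 0) (e₇ : z b b c c = 0) (e₈ : z b c c c = 0)
    (e₉ : z c c c c = 0) (p q r t : Fin 3) : z p q r t = 0 := by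
  simp only [hsum] at hz
  -- The apolarity equation at a quadratic monomial m determines the coefficient at a²m. The
  -- equations are taken by increasing power of a in m, so all other terms are already zero.
  have d₁ : z a a c c = 0 := by 
    simpa [h₁, h₂, h₃, e₁, e₂, e₃, e₄, e₅, e₆, e₇, e₈, e₉, hg] using hz c c
  have d₂ : z a a b c = 0 := by 
    simpa [h₁, h₂, h₃, e₁, e₂, e₃, e₄, e₅, e₆, e₇, e₈, e₉, d₁, hg] using hz b c
  have d₃ : z a a b b = 0 := by 
    simpa [h₁, h₂, h₃, e₁, e₂, e₃, e₄, e₅, e₆, e₇, e₈, e₉, d₁, d₂, hg] using hz b b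
  have d₄ : z a a a b = 0 := by 
    simpa [h₁, h₂, h₃, e₁, e₂, e₃, e₄, e₅, e₆, e₇, e₈, e₉, d₁, d₂, d₃, hg] using hz a b
  have d₅ : z a a a c = 0 := by 
    simpa [h₁, h₂, h₃, e₁, e₂, e₃, e₄, e₅, e₆, e₇, e₈, e₉, d₁, d₂, d₃, hg] using hz a c
  have d₆ : z a a a a = 0 := by 
    simpa [h₁, h₂, h₃, e₁, e₂, e₃, e₄, e₅, e₆, e₇, e₈, e₉, d₁, d₂, d₃, d₄, d₅, hg] using hz a a
  obtain hp | hp | hp := hcov p <;> obtain hq | hq | hq := hcov q <;>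
  obtain hr | hr | hr := hcov r <;> obtain ht | ht | ht := hcov t <;>
  simp only [hp, hq, hr, ht, h₁, h₂, h₃, e₁, e₂, e₃, e₄, e₅, e₆, e₇, e₈, e₉, d₁, d₂, d₃, d₄, d₅, d₆]

/-- A quartic apolar to a quadric without square terms and with a nonzero term `ab` vanishes as
soon as its coefficients at the monomials not divisible by `ab` vanish. -/
theorem quartic_eq_zero_of_offdiag {a b c : Fin 3} (hcov : ∀ i, i = a ∨ i = b ∨ i = c)
    (hsum : ∀ f : Fin 3 → ℂ, ∑ i, f i = f a + f b + f c)
    (h₁ : ∀ p q r t, z p q r t = z q p r t) (h₂ : ∀ p q r t, z p q r t = z p r q t)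
    (h₃ : ∀ p q r t, z p q r t = z p q t r) (hd : ∀ i, g i i = 0)
    (hsymm : ∀ i j, g i j = g j i) (hg : g a b ≠ 0)
    (hz : ∀ p q, ∑ r, ∑ t, g r t * z p q r t = 0)
    (e₁ : z a a a a = 0) (e₂ : z a a a c = 0) (e₃ : z a a c c = 0) (e₄ : z a c c c = 0)
    (e₅ : z b b b b = 0) (e₆ : z b b b c = 0) (e₇ : z b b c c = 0) (e₈ : z b c c c = 0)
    (e₉ : z c c c c = 0) (p q r t : Fin 3) : z p q r t = 0 := by
  simp only [hsum] at hz
  have hg' : g b a = g a b := hsymm b a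
  -- The equation at m now determines the coefficient at abm, and the equations are taken by
  -- decreasing power of c in m.
  have d₁ : z a b c c = 0 := by
    simpa [hd, h₁, h₂, h₃, e₁, e₂, e₃, e₄, e₅, e₆, e₇, e₈, e₉, hg, hg', ← two_mul] using hz c c
  have d₂ : z a a b c = 0 := by
    simpa [hd, h₁, h₂, h₃, e₁, e₂, e₃, e₄, e₅, e₆, e₇, e₈, e₉, d₁, hg, hg', ← two_mul] using hz a c
  have d₃ : z a b b c = 0 := by
    simpa [hd, h₁, h₂, h₃, e₁, e₂, e₃, e₄, e₅, e₆, e₇, e₈, e₉, d₁, d₂, hg, hg', ← two_mul]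
      using hz b c
  have d₄ : z a a a b = 0 := by
    simpa [hd, h₁, h₂, h₃, e₁, e₂, e₃, e₄, e₅, e₆, e₇, e₈, e₉, d₁, d₂, d₃, hg, hg', ← two_mul]
      using hz a a
  have d₅ : z a b b b = 0 := by
    simpa [hd, h₁, h₂, h₃, e₁, e₂, e₃, e₄, e₅, e₆, e₇, e₈, e₉, d₁, d₂, d₃, hg, hg', ← two_mul]
      using hz b b
  have d₆ : z a a b b = 0 := by
    simpa [hd, h₁, h₂, h₃, e₁, e₂, e₃, e₄, e₅, e₆, e₇, e₈, e₉, d₁, d₂, d₃, d₄, d₅, hg, hg',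
      ← two_mul] using hz a b
  obtain hp | hp | hp := hcov p <;> obtain hq | hq | hq := hcov q <;>
  obtain hr | hr | hr := hcov r <;> obtain ht | ht | ht := hcov t <;>
  simp only [hp, hq, hr, ht, h₁, h₂, h₃, e₁, e₂, e₃, e₄, e₅, e₆, e₇, e₈, e₉, d₁, d₂, d₃, d₄, d₅, d₆]

/-- The unordered pairs, with repetition, of indices in `Fin 6`. -/
abbrev OrderedPair : Type := {q : Fin 6 × Fin 6 // q.1 ≤ q.2}

/-- Twice the symmetric bilinear form with the given coefficients as a quadratic form in six
variables. -/
def polarForm : (OrderedPair → ℂ) →ₗ[ℂ] (Fin 6 → Fin 6 → ℂ) where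
  toFun Q u v := if h : u ≤ v then (if u = v then 2 else 1) * Q ⟨(u, v), h⟩
    else Q ⟨(v, u), (not_le.1 h).le⟩
  map_add' Q Q' := by
    ext u v
    simp only [Pi.add_apply]
    split_ifs <;> ring
  map_smul' c Q := by
    ext u v
    simp only [Pi.smul_apply, smul_eq_mul, RingHom.id_apply]
    split_ifs <;> ring

theorem polarForm_injective : Function.Injective polarForm := by
  rw [← LinearMap.ker_eq_bot, LinearMap.ker_eq_bot']
  intro Q hQ
  ext ⟨⟨u, v⟩, h⟩
  have := congrFun (congrFun hQ u) v
  have h' : u ≤ v := h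
  simp only [polarForm, LinearMap.coe_mk, AddHom.coe_mk, h', dif_pos, Pi.zero_apply] at this
  split_ifs at this <;> simpa using this

/-- A space of quadratic forms on the symmetric matrices that come from quartics apolar to a fixed
nonzero quadric has dimension at most nine. -/
theorem finrank_le_nine_of_apolar (K : Submodule ℂ (OrderedPair → ℂ)) (hg : g ≠ 0)
    (hsymm : ∀ i j, g i j = g j i)
    (hK : ∀ Q ∈ K, ∀ p q r t, polarForm Q (pairIdx p q) (pairIdx r t) =
      polarForm Q (pairIdx p r) (pairIdx q t))
    (hKg : ∀ Q ∈ K, ∀ p q, ∑ r, ∑ t, g r t * polarForm Q (pairIdx p q) (pairIdx r t) = 0) :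
    Module.finrank ℂ K ≤ 9 := by
  -- Of the fifteen quartic monomials, the nine not divisible by the chosen term of the quadric give
  -- coordinates that are injective on K.
  have main : ∀ m : Fin 9 → Fin 3 × Fin 3 × Fin 3 × Fin 3,
      (∀ Q ∈ K, (∀ n, polarForm Q (pairIdx (m n).1 (m n).2.1)
        (pairIdx (m n).2.2.1 (m n).2.2.2) = 0) →
        ∀ p q r t, polarForm Q (pairIdx p q) (pairIdx r t) = 0) → Module.finrank ℂ K ≤ 9 := by
    intro m hm
    let L : K →ₗ[ℂ] (Fin 9 → ℂ) := LinearMap.pi fun n =>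
      LinearMap.proj (pairIdx (m n).2.2.1 (m n).2.2.2) ∘ₗ
        LinearMap.proj (pairIdx (m n).1 (m n).2.1) ∘ₗ polarForm ∘ₗ K.subtype
    have hL : Function.Injective L := by
      rw [← LinearMap.ker_eq_bot, LinearMap.ker_eq_bot']
      intro Q hQ
      have h0 := hm Q Q.2 fun n => congrFun hQ n
      refine Subtype.ext (polarForm_injective ?_)
      rw [ZeroMemClass.coe_zero, map_zero]
      ext u v
      obtain ⟨p, q, rfl⟩ := exists_pairIdx_eq u
      obtain ⟨r, t, rfl⟩ := exists_pairIdx_eq v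
      exact h0 p q r t
    simpa using LinearMap.finrank_le_finrank_of_injective hL
  have h₁ : ∀ Q : OrderedPair → ℂ, ∀ p q r t, polarForm Q (pairIdx p q) (pairIdx r t) =
      polarForm Q (pairIdx q p) (pairIdx r t) := fun Q p q r t => by rw [pairIdx_comm p q]
  have h₃ : ∀ Q : OrderedPair → ℂ, ∀ p q r t, polarForm Q (pairIdx p q) (pairIdx r t) =
      polarForm Q (pairIdx p q) (pairIdx t r) := fun Q p q r t => by rw [pairIdx_comm r t]
  have diag : ∀ a b c : Fin 3, (∀ i, i = a ∨ i = b ∨ i = c) →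
      (∀ f : Fin 3 → ℂ, ∑ i, f i = f a + f b + f c) → g a a ≠ 0 → Module.finrank ℂ K ≤ 9 := by
    intro a b c hcov hsum hgaa
    refine main ![(a, b, b, b), (a, b, b, c), (a, b, c, c), (a, c, c, c), (b, b, b, b),
      (b, b, b, c), (b, b, c, c), (b, c, c, c), (c, c, c, c)] fun Q hQ h0 => ?_
    exact quartic_eq_zero_of_diag
      (z := fun p q r t => polarForm Q (pairIdx p q) (pairIdx r t)) hcov hsum (h₁ Q) (hK Q hQ)
      (h₃ Q) hgaa (hKg Q hQ) (h0 0) (h0 1) (h0 2) (h0 3) (h0 4) (h0 5) (h0 6) (h0 7) (h0 8)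
  have offdiag : ∀ a b c : Fin 3, (∀ i, i = a ∨ i = b ∨ i = c) →
      (∀ f : Fin 3 → ℂ, ∑ i, f i = f a + f b + f c) → (∀ i, g i i = 0) → g a b ≠ 0 →
      Module.finrank ℂ K ≤ 9 := by
    intro a b c hcov hsum hd hgab
    refine main ![(a, a, a, a), (a, a, a, c), (a, a, c, c), (a, c, c, c), (b, b, b, b),
      (b, b, b, c), (b, b, c, c), (b, c, c, c), (c, c, c, c)] fun Q hQ h0 => ?_
    exact quartic_eq_zero_of_offdiag
      (z := fun p q r t => polarForm Q (pairIdx p q) (pairIdx r t)) hcov hsum (h₁ Q) (hK Q hQ)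
      (h₃ Q) hd hsymm hgab (hKg Q hQ) (h0 0) (h0 1) (h0 2) (h0 3) (h0 4) (h0 5) (h0 6) (h0 7)
      (h0 8)
  have hcyc : ∀ a b c : Fin 3, a ≠ b → a ≠ c → b ≠ c → (∀ i, i = a ∨ i = b ∨ i = c) ∧
      ∀ f : Fin 3 → ℂ, ∑ i, f i = f a + f b + f c := by
    intro a b c hab hac hbc
    refine ⟨by revert a b c; decide, fun f => ?_⟩
    have : (Finset.univ : Finset (Fin 3)) = {a, b, c} := by revert a b c; decide
    rw [this, Finset.sum_insert (by simp [hab, hac]), Finset.sum_insert (by simp [hbc]),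
      Finset.sum_singleton, add_assoc]
  have hthird : ∀ a b : Fin 3, ∃ b' c : Fin 3, a ≠ b' ∧ a ≠ c ∧ b' ≠ c ∧ (a ≠ b → b' = b) := by
    decide
  -- Without a change of basis, a nonzero quadric has either a square term or only mixed terms.
  by_cases hd : ∀ i, g i i = 0
  · obtain ⟨a, ha⟩ := Function.ne_iff.1 hg
    obtain ⟨b, hb⟩ := Function.ne_iff.1 ha
    obtain ⟨b', c, hab, hac, hbc, hbb⟩ := hthird a b
    obtain rfl := hbb fun h => hb (h ▸ hd a)
    obtain ⟨h, h'⟩ := hcyc a b' c hab hac hbc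
    exact offdiag a b' c h h' hd hb
  · push Not at hd
    obtain ⟨a, ha⟩ := hd
    obtain ⟨b, c, hab, hac, hbc, -⟩ := hthird a a
    obtain ⟨h, h'⟩ := hcyc a b c hab hac hbc
    exact diag a b c h h' ha

end Syzygy
end

noncomputable section

/-! ### Products of cubics with the coordinates of ℂ⁶ -/

section Prolongation

/-- Bilinear forms on `ℂ³ × Sym²ℂ³` that come from cubic forms on `ℂ³`. -/
def symCubic : Submodule ℂ (Fin 3 × Fin 6 → ℂ) where
  carrier := {F | ∀ a i l, F (a, pairIdx i l) = F (l, pairIdx i a)}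
  add_mem' hF hG a i l := by simp [hF a i l, hG a i l]
  zero_mem' _ _ _ := rfl
  smul_mem' c F hF a i l := by simp [hF a i l]

/-- Eight of the exchange relations imply all the others, and 18 - 8 = 10. -/
theorem ten_le_finrank_symCubic : 10 ≤ Module.finrank ℂ symCubic := by
  let m : Fin 8 → Fin 3 × Fin 3 × Fin 3 := ![(0, 0, 1), (0, 0, 2), (0, 1, 1), (0, 1, 2), (0, 2, 1),
    (0, 2, 2), (1, 1, 2), (1, 2, 2)]
  let L : (Fin 3 × Fin 6 → ℂ) →ₗ[ℂ] (Fin 8 → ℂ) := LinearMap.pi fun n =>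
    LinearMap.proj (R := ℂ) (φ := fun _ : Fin 3 × Fin 6 => ℂ)
      ((m n).1, pairIdx (m n).2.1 (m n).2.2) -
      LinearMap.proj ((m n).2.2, pairIdx (m n).2.1 (m n).1)
  have hker : LinearMap.ker L ≤ symCubic := by
    intro F hF
    have h := fun n => congrFun (LinearMap.mem_ker.1 hF) n
    simp only [Fin.forall_fin_succ, L, m, LinearMap.pi_apply, LinearMap.sub_apply,
      LinearMap.proj_apply, Matrix.cons_val_zero, Matrix.cons_val_succ, pairIdx,
      Pi.zero_apply, sub_eq_zero, IsEmpty.forall_iff, and_true, Matrix.cons_val_one,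
      Matrix.cons_val] at h
    obtain ⟨h1, h2, h3, h4, h5, h6, h7, h8⟩ := h
    have h9 : F (1, 2) = F (2, 1) := h5.symm.trans h4
    intro a i l
    fin_cases a <;> fin_cases i <;> fin_cases l <;> simp [pairIdx, *]
  have h1 := L.finrank_range_add_finrank_ker
  have h2 : Module.finrank ℂ (LinearMap.range L) ≤ 8 := by
    simpa using Submodule.finrank_le (LinearMap.range L)
  have h3 := Submodule.finrank_mono hker
  have h4 : Module.finrank ℂ (Fin 3 × Fin 6 → ℂ) = 18 := by simp
  omega

/-- The product of bilinear forms on `ℂ³ × ℂ⁶` with the coordinates of `ℂ⁶`, as forms linear on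
`ℂ³` and quadratic on `ℂ⁶`. -/
def prolong : (Fin 6 → Fin 3 × Fin 6 → ℂ) →ₗ[ℂ] (Fin 3 × OrderedPair → ℂ) where
  toFun G x := if x.2.1.1 = x.2.1.2 then G x.2.1.1 (x.1, x.2.1.1)
    else G x.2.1.1 (x.1, x.2.1.2) + G x.2.1.2 (x.1, x.2.1.1)
  map_add' G G' := by
    ext x
    simp only [Pi.add_apply]
    split_ifs <;> ring
  map_smul' c G := by
    ext x
    simp only [Pi.smul_apply, smul_eq_mul, RingHom.id_apply]
    split_ifs <;> ring

theorem polarForm_prolong (G : Fin 6 → Fin 3 × Fin 6 → ℂ) (p : Fin 3) (u v : Fin 6) :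
    polarForm (fun x => prolong G (p, x)) u v = G u (p, v) + G v (p, u) := by
  simp only [polarForm, prolong, LinearMap.coe_mk, AddHom.coe_mk]
  obtain h | rfl | h := lt_trichotomy u v
  · simp [h.le, h.ne]
  · simp [two_mul]
  · simp [not_le.2 h, h.ne]
    ring

/-- Inversion of the prolongation: the cubics are recovered from their polarized products. The case
H = 0 excludes linear syzygies, and H supported on one coordinate of ℂ³ is the situation of V · K.
-/
theorem two_mul_cubic_eq {G : Fin 6 → Fin 3 × Fin 6 → ℂ} (hG : ∀ u, G u ∈ symCubic)
    {H : Fin 3 → Fin 6 → Fin 6 → ℂ} (hH : ∀ p u v, G u (p, v) + G v (p, u) = H p u v)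
    (p q i r s : Fin 3) : 2 * G (pairIdx p q) (i, pairIdx r s) =
      2 * H r (pairIdx p q) (pairIdx i s) - H p (pairIdx i s) (pairIdx r q)
        - H q (pairIdx i s) (pairIdx r p) + H s (pairIdx r q) (pairIdx i p)
        - H r (pairIdx i p) (pairIdx s q) + H i (pairIdx s q) (pairIdx r p) :=
  two_mul_eq_of_add_swap_eq (fun p q i r s => G (pairIdx p q) (i, pairIdx r s))
    (fun i p q r s => H i (pairIdx p q) (pairIdx r s))
    (fun p q i r s => by simp only [pairIdx_comm p q])
    (fun p q i r s => by simp only [pairIdx_comm r s])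
    (fun p q i r s => by
      rw [pairIdx_comm r s, hG _ i s r, pairIdx_comm s i])
    (fun i p q r s => hH i _ _) p q i r s

/-- There are no linear syzygies among the bilinear forms that come from cubics. -/
theorem eq_zero_of_prolong_eq_zero {G : Fin 6 → Fin 3 × Fin 6 → ℂ} (hG : ∀ u, G u ∈ symCubic)
    (h : prolong G = 0) : G = 0 := by
  have hH : ∀ p u v, G u (p, v) + G v (p, u) = (0 : Fin 3 → Fin 6 → Fin 6 → ℂ) p u v := by
    intro p u v
    rw [← polarForm_prolong, h]
    exact congrFun (congrFun (map_zero polarForm) u) v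
  ext u ⟨i, v⟩
  obtain ⟨p, q, rfl⟩ := exists_pairIdx_eq u
  obtain ⟨r, s, rfl⟩ := exists_pairIdx_eq v
  have := two_mul_cubic_eq hG hH p q i r s
  simpa using this

variable {q : Fin 6 → Fin 6 → ℂ} {G : Fin 3 → Fin 6 → Fin 3 × Fin 6 → ℂ}

/-- A quadratic form on the symmetric matrices whose products with the coordinates of `ℂ³` are
generated by cubics is itself a quartic. -/
theorem quartic_of_prolong (hG : ∀ α u, G α u ∈ symCubic)
    (hH : ∀ α p u v, G α u (p, v) + G α v (p, u) = if p = α then q u v else 0)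
    (p q' r t : Fin 3) :
    q (pairIdx p q') (pairIdx r t) = q (pairIdx p r) (pairIdx q' t) := by
  by_cases hqr : q' = r
  · rw [hqr]
  -- The inversion formula expands one cubic coefficient in two ways. For α different from q' and r,
  -- the possible contributions of t = α and p = α agree on both sides and cancel, leaving exactly
  -- the desired equality.
  obtain ⟨α, h1, h2⟩ : ∃ α, q' ≠ α ∧ r ≠ α := by
    revert q' r; decide
  have e1 := two_mul_cubic_eq (hG α) (hH α) t p q' r α
  have e2 := two_mul_cubic_eq (hG α) (hH α) t p α r q'
  have e3 : G α (pairIdx t p) (q', pairIdx r α) = G α (pairIdx t p) (α, pairIdx r q') :=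
    hG α _ q' r α
  rw [e3, e2] at e1
  simp only [if_neg h1, if_neg h2, if_true, pairIdx_comm α q'] at e1
  rw [pairIdx_comm p q', pairIdx_comm p r, pairIdx_comm q' t, pairIdx_comm r t] at *
  linear_combination e1

/-- If moreover the cubics are killed by a cubic differential operator with coefficients `f`, then
the quartic is killed by the derivatives of that operator. -/
theorem apolar_of_prolong (hG : ∀ α u, G α u ∈ symCubic)
    (hH : ∀ α p u v, G α u (p, v) + G α v (p, u) = if p = α then q u v else 0)
    {f : Fin 3 → Fin 3 → Fin 3 → ℂ} (f₁ : ∀ i r s, f i r s = f r i s)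
    (f₂ : ∀ i r s, f i r s = f i s r)
    (hf : ∀ α u, ∑ i, ∑ r, ∑ s, f i r s * G α u (i, pairIdx r s) = 0) (α p q' : Fin 3) :
    ∑ r, ∑ t, f α r t * q (pairIdx p q') (pairIdx r t) = 0 := by
  have hs := quartic_of_prolong hG hH
  let z : Fin 3 → Fin 3 → Fin 3 → Fin 3 → ℂ := fun a b c d => q (pairIdx a b) (pairIdx c d)
  have z₁ : ∀ a b c d, z a b c d = z b a c d := fun a b c d => by simp only [z, pairIdx_comm a b]
  have z₃ : ∀ a b c d, z a b c d = z a b d c := fun a b c d => by simp only [z, pairIdx_comm c d]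
  have z₂ : ∀ a b c d, z a b c d = z a c b d := hs
  let w : Fin 3 → ℂ := fun a => ∑ i, ∑ r, ∑ s, f i r s * z a i r s
  have hF : ∀ α p q' i r s, 2 * G α (pairIdx p q') (i, pairIdx r s) =
      (if r = α then z p q' i s else 0) + (if s = α then z p q' i r else 0) +
        (if i = α then z p q' r s else 0) - (if p = α then z q' i r s else 0)
        - (if q' = α then z p i r s else 0) := by
    intro α p q' i r s
    have e : 2 * G α (pairIdx p q') (i, pairIdx r s) = 2 * (if r = α then z p q' i s else 0)
        - (if p = α then z i s r q' else 0) - (if q' = α then z i s r p else 0)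
        + (if s = α then z r q' i p else 0) - (if r = α then z i p s q' else 0)
        + (if i = α then z s q' r p else 0) := two_mul_cubic_eq (hG α) (hH α) p q' i r s
    have rot : ∀ a b c d, z a b c d = z d a b c := fun a b c d =>
      (z₃ a b c d).trans ((z₂ a b d c).trans (z₁ a d b c))
    have e1 : z i s r q' = z q' i r s := (rot ..).trans (z₃ ..)
    have e2 : z i s r p = z p i r s := (rot ..).trans (z₃ ..)
    have e3 : z r q' i p = z p q' i r := (rot ..).trans ((z₂ ..).trans (z₃ ..))
    have e4 : z i p s q' = z p q' i s := (z₁ ..).trans ((z₃ ..).trans (z₂ ..))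
    have e5 : z s q' r p = z p q' r s := (rot ..).trans ((z₂ ..).trans (z₃ ..))
    rw [e, e1, e2, e3, e4, e5]
    ring
  have hmain : ∀ α p q', 3 * ∑ r, ∑ t, f α r t * z p q' r t =
      (if p = α then w q' else 0) + (if q' = α then w p else 0) := by
    intro α p q'
    have h0 : ∑ i, ∑ r, ∑ s, f i r s * (2 * G α (pairIdx p q') (i, pairIdx r s)) = 0 := by
      simp only [mul_left_comm _ (2 : ℂ), ← Finset.mul_sum, hf, mul_zero]
    simp only [hF, mul_sub, mul_add, mul_ite, mul_zero, Finset.sum_add_distrib,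
      Finset.sum_sub_distrib, Finset.sum_ite_irrel, Finset.sum_const_zero, Finset.sum_ite_eq',
      Finset.mem_univ, if_true] at h0
    have t1 : ∑ i, ∑ s, f i α s * z p q' i s = ∑ r, ∑ t, f α r t * z p q' r t :=
      Finset.sum_congr rfl fun i _ => Finset.sum_congr rfl fun s _ => by rw [f₁]
    have t2 : ∑ i, ∑ r, f i r α * z p q' i r = ∑ r, ∑ t, f α r t * z p q' r t :=
      Finset.sum_congr rfl fun i _ => Finset.sum_congr rfl fun s _ => by rw [f₂, f₁]
    rw [t1, t2] at h0
    linear_combination h0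
  -- Setting p = α in `hmain` and summing over α gives 3w on the left, and 3w + w on the right.
  have hw : ∀ a, w a = 0 := by
    intro a
    have h1 : ∑ α, 3 * ∑ r, ∑ t, f α r t * z α a r t = 3 * w a := by
      rw [← Finset.mul_sum]
      simp only [z₁ _ a]
      rfl
    simp only [hmain, if_true, Finset.sum_add_distrib, Finset.sum_const, Finset.card_univ,
      Fintype.card_fin, Finset.sum_ite_eq, Finset.mem_univ, nsmul_eq_mul] at h1
    push_cast at h1
    linear_combination h1
  have := hmain α p q'
  simp only [hw, ite_self, add_zero] at this
  simpa using this

end Prolongation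
end

noncomputable section

/-! ### Limits of subspaces along an ultrafilter -/

section UltraLimit

open Filter Topology

variable {ι E F : Type*} [NormedAddCommGroup E] [NormedSpace ℂ E] [NormedAddCommGroup F]
  [NormedSpace ℂ F]

/-- The limits along an ultrafilter of the vectors of a family of subspaces. -/
def ultraLim (𝒰 : Ultrafilter ι) (U : ι → Submodule ℂ E) : Submodule ℂ E where
  carrier := {w | ∃ u : ι → E, (∀ i, u i ∈ U i) ∧ Tendsto u 𝒰 (𝓝 w)}
  add_mem' := by
    rintro _ _ ⟨u, hu, hu'⟩ ⟨v, hv, hv'⟩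
    exact ⟨fun i => u i + v i, fun i => add_mem (hu i) (hv i), hu'.add hv'⟩
  zero_mem' := ⟨0, fun i => zero_mem _, tendsto_const_nhds⟩
  smul_mem' := by
    rintro c _ ⟨u, hu, hu'⟩
    exact ⟨fun i => c • u i, fun i => Submodule.smul_mem _ _ (hu i), hu'.const_smul c⟩

/-- Linear independence is an open condition: vectors of the subspaces that approximate a basis of
the limit are eventually independent. -/
theorem finrank_ultraLim_le [FiniteDimensional ℂ E] (𝒰 : Ultrafilter ι) (U : ι → Submodule ℂ E)
    (d : ℕ) (h : ∀ᶠ i in 𝒰, Module.finrank ℂ (U i) ≤ d) :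
    Module.finrank ℂ (ultraLim 𝒰 U) ≤ d := by
  let b := Module.finBasis ℂ (ultraLim 𝒰 U)
  choose u hu hlim using fun k => (b k).2
  have hli : LinearIndependent ℂ fun k => (b k : E) :=
    b.linearIndependent.map' (ultraLim 𝒰 U).subtype (Submodule.ker_subtype _)
  have ht : Tendsto (fun i k => u k i) 𝒰 (𝓝 fun k => (b k : E)) := tendsto_pi_nhds.2 hlim
  obtain ⟨i, hi, hd⟩ := ((ht.eventually hli.eventually).and h).exists
  refine le_trans ?_ hd
  have hli' : LinearIndependent ℂ fun k => (⟨u k i, hu k i⟩ : U i) :=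
    LinearIndependent.of_comp (U i).subtype hi
  simpa using hli'.fintype_card_le_finrank

/-- The frame is zero when the subspace is too small, so that a family of such frames stays in a
compact ball at every index. -/
theorem exists_orthonormal_mem {V : Type*} [NormedAddCommGroup V] [InnerProductSpace ℂ V]
    [FiniteDimensional ℂ V] (U : Submodule ℂ V) (d : ℕ) :
    ∃ v : Fin d → V, (∀ k, v k ∈ U) ∧ (∀ k, ‖v k‖ ≤ 1) ∧
      (d ≤ Module.finrank ℂ U → Orthonormal ℂ v) := by
  by_cases h : d ≤ Module.finrank ℂ U
  · have ho : Orthonormal ℂ fun k => (stdOrthonormalBasis ℂ U (Fin.castLE h k) : V) :=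
      ((stdOrthonormalBasis ℂ U).orthonormal.comp_linearIsometry U.subtypeₗᵢ).comp _
        (Fin.castLE_injective h)
    exact ⟨_, fun _ => Subtype.prop _, fun k => (ho.1 k).le, fun _ => ho⟩
  · exact ⟨0, fun _ => zero_mem _, fun _ => by simp, fun h' => absurd h' h⟩

/-- Orthonormal frames in the subspaces converge along the ultrafilter by compactness, and the limit
frame is again orthonormal. -/
theorem le_finrank_ultraLim {κ : Type*} [Fintype κ] (𝒰 : Ultrafilter ι)
    (U : ι → Submodule ℂ (κ → ℂ)) (d : ℕ)
    (h : ∀ᶠ i in 𝒰, d ≤ Module.finrank ℂ (U i)) :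
    d ≤ Module.finrank ℂ (ultraLim 𝒰 U) := by
  let e := (EuclideanSpace.equiv κ ℂ)
  let U' : ι → Submodule ℂ (EuclideanSpace ℂ κ) := fun i => (U i).comap e.toLinearMap
  have hU' : ∀ i, Module.finrank ℂ (U' i) = Module.finrank ℂ (U i) := fun i => by
    have : U' i = (U i).map e.symm.toLinearEquiv.toLinearMap := by
      ext x
      simp [U']
    rw [this, LinearEquiv.finrank_map_eq]
  choose v hv hv1 ho using fun i => exists_orthonormal_mem (U' i) d
  obtain ⟨w, -, hw⟩ := (isCompact_closedBall (0 : Fin d → EuclideanSpace ℂ κ) 1).ultrafilter_le_nhds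
    (𝒰.map v) (by
      refine tendsto_principal.2 (Filter.Eventually.of_forall fun i => ?_)
      rw [mem_closedBall_zero_iff, pi_norm_le_iff_of_nonneg zero_le_one]
      exact hv1 i)
  have hw' : ∀ k, Tendsto (fun i => v i k) 𝒰 (𝓝 (w k)) := fun k =>
    ((continuous_apply k).tendsto w).comp hw
  have how : Orthonormal ℂ w := by
    rw [orthonormal_iff_ite]
    intro k l
    refine tendsto_nhds_unique ((hw' k).inner (hw' l)) ?_
    refine tendsto_const_nhds.congr' (h.mono fun i hi => ?_)
    exact (orthonormal_iff_ite.1 (ho i ((hU' i).symm ▸ hi)) k l).symm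
  have hmem : ∀ k, e (w k) ∈ ultraLim 𝒰 U := fun k =>
    ⟨fun i => e (v i k), fun i => hv i k, (e.continuous.tendsto _).comp (hw' k)⟩
  have hli : LinearIndependent ℂ fun k => (⟨e (w k), hmem k⟩ : ultraLim 𝒰 U) :=
    LinearIndependent.of_comp (ultraLim 𝒰 U).subtype
      (how.linearIndependent.map' e.toLinearMap e.toLinearEquiv.ker)
  simpa using hli.fintype_card_le_finrank

theorem map_mem_ultraLim [FiniteDimensional ℂ E] {𝒰 : Ultrafilter ι} {U : ι → Submodule ℂ E}
    {V : ι → Submodule ℂ F} (L : E →ₗ[ℂ] F) (hL : ∀ i, ∀ w ∈ U i, L w ∈ V i) {w : E}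
    (hw : w ∈ ultraLim 𝒰 U) : L w ∈ ultraLim 𝒰 V := by
  obtain ⟨u, hu, hlim⟩ := hw
  exact ⟨fun i => L (u i), fun i => hL i _ (hu i),
    (L.continuous_of_finiteDimensional.tendsto w).comp hlim⟩

end UltraLimit

/-! ### From nine cubics to quartics apolar to a quadric -/

section Apolarity

/-- The ten-dimensional space of cubics bounds a space of quadratic forms whose products with the
coordinates of `ℂ³` lie in the prolongation of a space of at most nine cubics. -/
theorem finrank_le_nine_of_prolong (J : Submodule ℂ (Fin 3 × Fin 6 → ℂ)) (hJ : J ≤ symCubic)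
    (hJ9 : Module.finrank ℂ J ≤ 9) (K : Submodule ℂ (OrderedPair → ℂ))
    (hK : ∀ Q ∈ K, ∀ α, ∃ G : Fin 6 → Fin 3 × Fin 6 → ℂ, (∀ u, G u ∈ J) ∧
      prolong G = fun x => if x.1 = α then Q x.2 else 0) : Module.finrank ℂ K ≤ 9 := by
  obtain ⟨F₀, hF₀, hF₀J⟩ : ∃ F₀ ∈ symCubic, F₀ ∉ J := by
    by_contra! hle
    have := Submodule.finrank_mono hle
    have := ten_le_finrank_symCubic
    omega
  obtain ⟨φ, hφ, hφJ⟩ := Submodule.exists_le_ker_of_notMem hF₀J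
  -- A sum over r and s meets each pair of distinct indices twice, hence the factor 1/2.
  let c : Fin 3 → Fin 3 → Fin 3 → ℂ := fun i r s =>
    φ (Pi.single (i, pairIdx r s) 1) * if r = s then 1 else 1 / 2
  have hc : ∀ i r s, c i r s = c i s r := fun i r s => by
    simp only [c, pairIdx_comm r s, eq_comm (a := r)]
  have hφc : ∀ F, ∑ i, ∑ r, ∑ s, c i r s * F (i, pairIdx r s) = φ F := fun F => by
    conv_rhs => rw [← Finset.univ_sum_single F, map_sum, Fintype.sum_prod_type]
    refine Finset.sum_congr rfl fun i _ => ?_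
    have : ∀ u, φ (Pi.single (i, u) (F (i, u))) = φ (Pi.single (i, u) 1) * F (i, u) := fun u => by
      rw [mul_comm, ← smul_eq_mul, ← map_smul, ← Pi.single_smul, smul_eq_mul, mul_one]
    simp only [this, c]
    simp [Fin.sum_univ_succ, pairIdx]
    ring
  -- The symmetrization of c is a cubic operator that pairs with cubics as 3φ. It kills J and is
  -- nonzero because of `F₀`; a nonzero derivative `f α` is the quadric.
  let f : Fin 3 → Fin 3 → Fin 3 → ℂ := fun i r s => c i r s + c r i s + c s i r
  have f₁ : ∀ i r s, f i r s = f r i s := fun i r s => by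
    simp only [f, hc s i r]
    ring
  have f₂ : ∀ i r s, f i r s = f i s r := fun i r s => by
    simp only [f, hc i r s]
    ring
  have hfφ : ∀ F ∈ symCubic, ∑ i, ∑ r, ∑ s, f i r s * F (i, pairIdx r s) = 3 * φ F := by
    intro F hF
    have e1 : ∑ i, ∑ r, ∑ s, c r i s * F (i, pairIdx r s) = φ F := by
      rw [Finset.sum_comm, ← hφc]
      refine Finset.sum_congr rfl fun i _ => Finset.sum_congr rfl fun r _ =>
        Finset.sum_congr rfl fun s _ => ?_
      rw [pairIdx_comm i s, hF, pairIdx_comm s r]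
    have e2 : ∑ i, ∑ r, ∑ s, c s i r * F (i, pairIdx r s) = φ F := by
      rw [← hφc]
      have : ∀ i, ∑ r, ∑ s, c s i r * F (i, pairIdx r s) =
        ∑ s, ∑ r, c s i r * F (i, pairIdx r s) := fun i => Finset.sum_comm
      simp only [this]
      rw [Finset.sum_comm]
      refine Finset.sum_congr rfl fun i _ => Finset.sum_congr rfl fun r _ =>
        Finset.sum_congr rfl fun s _ => ?_
      rw [hF, pairIdx_comm s r]
    simp only [f, add_mul, Finset.sum_add_distrib, e1, e2, hφc]
    ring
  obtain ⟨α, hα⟩ : ∃ α, f α ≠ 0 := by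
    by_contra! hf0
    have := hfφ F₀ hF₀
    simp only [hf0, Pi.zero_apply, zero_mul, Finset.sum_const_zero] at this
    exact hφ (by simpa using this.symm)
  have hpol : ∀ Q ∈ K, ∃ G : Fin 3 → Fin 6 → Fin 3 × Fin 6 → ℂ, (∀ α u, G α u ∈ J) ∧
      ∀ α p u v, G α u (p, v) + G α v (p, u) = if p = α then polarForm Q u v else 0 := by
    intro Q hQ
    choose G hGJ hG using hK Q hQ
    refine ⟨G, hGJ, fun α p u v => ?_⟩
    rw [← polarForm_prolong, hG]
    split_ifs with h
    · simp [h]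
    · simp only [h, if_false]
      exact congrFun (congrFun (map_zero polarForm) u) v
  refine finrank_le_nine_of_apolar K hα (f₂ α) (fun Q hQ => ?_) fun Q hQ p q => ?_
  · obtain ⟨G, hGJ, hG⟩ := hpol Q hQ
    exact quartic_of_prolong (fun α u => hJ (hGJ α u)) hG
  · obtain ⟨G, hGJ, hG⟩ := hpol Q hQ
    refine apolar_of_prolong (fun α u => hJ (hGJ α u)) hG f₁ f₂ (fun β u => ?_) α p q
    rw [hfφ _ (hJ (hGJ β u)), LinearMap.mem_ker.1 (hφJ (hGJ β u)), mul_zero]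

end Apolarity
end

noncomputable section

/-! ### Border apolarity: nine terms do not suffice -/

section LowerBound

open Filter Topology

/-- The Levi-Civita symbol. -/
def leviCivita : Fin 3 → Fin 3 → Fin 3 → ℂ :=
  ![![![0, 0, 0], ![0, 0, 1], ![0, -1, 0]], ![![0, 0, -1], ![0, 0, 0], ![1, 0, 0]],
    ![![0, 1, 0], ![-1, 0, 0], ![0, 0, 0]]]

/-- The coordinates of the invariant tensor. -/
def invariantCoord (a i j k l : Fin 3) : ℂ :=
  (if i = k then leviCivita a j l else 0) + (if i = l then leviCivita a j k else 0)

/-- The values of the vectors of coefficients `F` at a finite family of points with the monomial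
values `W`. -/
abbrev evalMap {κ : Type*} [Fintype κ] {n : ℕ} (W : Fin n → κ → ℂ) : (κ → ℂ) →ₗ[ℂ] (Fin n → ℂ) :=
  Matrix.mulVecLin (Matrix.of W)

theorem evalMap_apply {κ : Type*} [Fintype κ] {n : ℕ} (W : Fin n → κ → ℂ) (F : κ → ℂ) (r : Fin n) :
    evalMap W F r = ∑ x, W r x * F x := rfl

theorem card_le_finrank_ker_evalMap {κ : Type*} [Fintype κ] {n : ℕ} (W : Fin n → κ → ℂ) :
    Fintype.card κ ≤ Module.finrank ℂ (LinearMap.ker (evalMap W)) + n := by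
  have h1 := (evalMap W).finrank_range_add_finrank_ker
  have h2 := Submodule.finrank_le (LinearMap.range (evalMap W))
  simp only [Module.finrank_fintype_fun_eq_card, Fintype.card_fin] at h1 h2
  omega

theorem sum_orderedPair (g : Fin 6 → Fin 6 → ℂ) :
    ∑ x : OrderedPair, (if x.1.1 = x.1.2 then g x.1.1 x.1.1 else g x.1.1 x.1.2 + g x.1.2 x.1.1) =
      ∑ u, ∑ v, g u v := by
  rw [← Finset.sum_subtype (Finset.univ.filter fun q : Fin 6 × Fin 6 => q.1 ≤ q.2) (by simp)
    (fun x : Fin 6 × Fin 6 => if x.1 = x.2 then g x.1 x.1 else g x.1 x.2 + g x.2 x.1),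
    Finset.sum_filter, Fintype.sum_prod_type]
  simp only [Fin.sum_univ_six, Fin.isValue, Fin.reduceLE, Fin.reduceEq, if_true, if_false]
  ring

variable {n : ℕ} (a : Fin n → Fin 3 → ℂ) (c : Fin n → Fin 6 → ℂ)

/-- Values of the monomials of bidegree `(1, 1)` at the points `(a r, c r)`. -/
def monomials₁₁ (r : Fin n) (x : Fin 3 × Fin 6) : ℂ := a r x.1 * c r x.2

/-- Values of the monomials of bidegree `(1, 2)` at the points `(a r, c r)`. -/
def monomials₁₂ (r : Fin n) (x : Fin 3 × OrderedPair) : ℂ :=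
  a r x.1 * (c r x.2.1.1 * c r x.2.1.2)

/-- Values of the monomials of degree two at the points `c r`. -/
def monomials₀₂ (r : Fin n) (x : OrderedPair) : ℂ := c r x.1.1 * c r x.1.2

theorem evalMap_prolong (G : Fin 6 → Fin 3 × Fin 6 → ℂ) (r : Fin n) :
    evalMap (monomials₁₂ a c) (prolong G) r =
      ∑ u, c r u * evalMap (monomials₁₁ a c) (G u) r := by
  simp only [evalMap_apply, monomials₁₁, monomials₁₂, Fintype.sum_prod_type, Finset.mul_sum]
  rw [Finset.sum_comm (s := (Finset.univ : Finset (Fin 6)))]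
  refine Finset.sum_congr rfl fun p _ => ?_
  rw [← sum_orderedPair fun u v => c r u * (a r p * c r v * G u (p, v))]
  refine Finset.sum_congr rfl fun x _ => ?_
  obtain ⟨⟨u, v⟩, hx⟩ := x
  simp only [prolong, LinearMap.coe_mk, AddHom.coe_mk]
  split_ifs with h
  · rw [h]; ring
  · ring

theorem prolong_mem_ker {G : Fin 6 → Fin 3 × Fin 6 → ℂ}
    (hG : ∀ u, G u ∈ LinearMap.ker (evalMap (monomials₁₁ a c))) :
    prolong G ∈ LinearMap.ker (evalMap (monomials₁₂ a c)) := by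
  rw [LinearMap.mem_ker]
  ext r
  rw [evalMap_prolong]
  simp [LinearMap.mem_ker.1 (hG _)]

/-- Multiplication by a linear form on `ℂ³`. -/
def mulCoord (α : Fin 3) : (OrderedPair → ℂ) →ₗ[ℂ] (Fin 3 × OrderedPair → ℂ) where
  toFun Q x := if x.1 = α then Q x.2 else 0
  map_add' Q Q' := by
    ext x
    simp only [Pi.add_apply]
    split_ifs <;> simp
  map_smul' c Q := by
    ext x
    simp

theorem mulCoord_mem_ker (α : Fin 3) {Q : OrderedPair → ℂ}
    (hQ : Q ∈ LinearMap.ker (evalMap (monomials₀₂ c))) :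
    mulCoord α Q ∈ LinearMap.ker (evalMap (monomials₁₂ a c)) := by
  rw [LinearMap.mem_ker] at hQ ⊢
  ext r
  have := congrFun hQ r
  rw [evalMap_apply] at this ⊢
  simp only [monomials₀₂, monomials₁₂, mulCoord, LinearMap.coe_mk, AddHom.coe_mk,
    Fintype.sum_prod_type, mul_ite, mul_zero] at this ⊢
  rw [Finset.sum_eq_single α (fun p _ hp => by simp [hp]) (by simp)]
  simp only [if_true, mul_assoc, ← Finset.mul_sum] at this ⊢
  rw [this]
  simp

/-- Points that impose independent conditions on forms of bidegree `(1, 1)` impose independent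
conditions on forms of bidegree `(1, 2)`. -/
theorem finrank_ker_monomials₁₂_le :
    Module.finrank ℂ (LinearMap.ker (evalMap (monomials₁₂ a c))) ≤
      45 + Module.finrank ℂ (LinearMap.ker (evalMap (monomials₁₁ a c))) := by
  -- Multiplication by a linear form that is nonzero at every nonzero `c r` rescales the values at
  -- these points by nonzero factors. Points with `c r = 0` impose no condition in either degree.
  obtain ⟨h, hh⟩ := Module.exists_dual_forall_apply_ne_zero (K := ℂ)
    (fun r : {r // c r ≠ 0} => c r) fun r => r.2
  let Λ : (Fin 3 × Fin 6 → ℂ) →ₗ[ℂ] (Fin 3 × OrderedPair → ℂ) :=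
    prolong ∘ₗ LinearMap.pi fun u => h (Pi.single u 1) • LinearMap.id
  have hΛ : ∀ F r, evalMap (monomials₁₂ a c) (Λ F) r =
      h (c r) * evalMap (monomials₁₁ a c) F r := by
    intro F r
    have : h (c r) = ∑ u, c r u * h (Pi.single u 1) := by
      conv_lhs => rw [← Finset.univ_sum_single (c r), map_sum]
      refine Finset.sum_congr rfl fun u _ => ?_
      rw [← smul_eq_mul, ← map_smul, ← Pi.single_smul, smul_eq_mul, mul_one]
    simp only [Λ, LinearMap.comp_apply, evalMap_prolong]
    rw [this, Finset.sum_mul]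
    refine Finset.sum_congr rfl fun u _ => ?_
    simp only [LinearMap.pi_apply, LinearMap.smul_apply, LinearMap.id_apply, map_smul,
      Pi.smul_apply, smul_eq_mul]
    ring
  have hker : LinearMap.ker (evalMap (monomials₁₂ a c) ∘ₗ Λ) ≤
      LinearMap.ker (evalMap (monomials₁₁ a c)) := by
    intro F hF
    rw [LinearMap.mem_ker] at hF ⊢
    ext r
    by_cases hr : c r = 0
    · simp [evalMap_apply, monomials₁₁, hr]
    · have := congrFun hF r
      rw [LinearMap.comp_apply, hΛ] at this
      exact (mul_eq_zero.1 this).resolve_left (hh ⟨r, hr⟩)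
  -- The rank of evaluation does not drop from bidegree (1,1) to (1,2), and 3 · 21 - 3 · 6 = 45.
  have h1 := (evalMap (monomials₁₂ a c)).finrank_range_add_finrank_ker
  have h2 := (evalMap (monomials₁₂ a c) ∘ₗ Λ).finrank_range_add_finrank_ker
  have h3 := Submodule.finrank_mono hker
  have h4 := Submodule.finrank_mono (LinearMap.range_comp_le_range Λ (evalMap (monomials₁₂ a c)))
  have h5 : Fintype.card OrderedPair = 21 := by decide
  simp only [Module.finrank_fintype_fun_eq_card, Fintype.card_prod, Fintype.card_fin, h5] at h1 h2
  omega

/-- The forms that annihilate the invariant tensor come from cubics. -/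
theorem mem_symCubic_of_annihilates {F : Fin 3 × Fin 6 → ℂ}
    (h : ∀ i j, ∑ p, ∑ k, ∑ l, F (p, pairIdx k l) * invariantCoord p i j k l = 0) :
    F ∈ symCubic := by
  -- The delta in the invariant contracts one index of the pair with i. What remains says that F is
  -- symmetric in p and l.
  have key : ∀ i j, ∑ p, ∑ l, F (p, pairIdx i l) * leviCivita p j l = 0 := by
    intro i j
    have h1 : ∀ p, ∑ k, ∑ l, F (p, pairIdx k l) * invariantCoord p i j k l =
        2 * ∑ l, F (p, pairIdx i l) * leviCivita p j l := by
      intro p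
      simp only [invariantCoord, mul_add, Finset.sum_add_distrib, mul_ite, mul_zero]
      rw [Finset.sum_eq_single i (fun k _ hk => by simp [hk.symm]) (by simp)]
      simp only [if_true, Finset.sum_ite_eq, Finset.mem_univ, pairIdx_comm _ i]
      ring
    have h2 := h i j
    simp only [h1, ← Finset.mul_sum] at h2
    simpa using h2
  intro a i l
  have h0 := key i 0
  have h1 := key i 1
  have h2 := key i 2
  simp only [leviCivita, Fin.sum_univ_three, Matrix.cons_val] at h0 h1 h2
  fin_cases a <;> fin_cases l <;> simp only [Fin.zero_eta, Fin.mk_one, Fin.reduceFinMk] <;>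
    first
    | rfl
    | linear_combination h0
    | linear_combination -h0
    | linear_combination h1
    | linear_combination -h1
    | linear_combination h2
    | linear_combination -h2

/-- The invariant tensor is not a limit of sums of nine decomposable tensors. -/
theorem not_tendsto_invariantCoord {ι : Type*} (𝒰 : Ultrafilter ι) (a : ι → Fin 9 → Fin 3 → ℂ)
    (N M : ι → Fin 9 → Fin 3 → Fin 3 → ℂ)
    (h : ∀ p i j k l, Tendsto (fun x => ∑ r, a x r p * (N x r i j * M x r k l)) 𝒰
      (𝓝 (invariantCoord p i j k l))) : False := by
  -- Both orders of a pair are added, so that pairing with `c` is the full contraction with `M`.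
  let c : ι → Fin 9 → Fin 6 → ℂ := fun x r u =>
    ∑ k, ∑ l, if pairIdx k l = u then M x r k l else 0
  have hc : ∀ x r (F : Fin 6 → ℂ), ∑ u, c x r u * F u = ∑ k, ∑ l, M x r k l * F (pairIdx k l) := by
    intro x r F
    simp only [c, Finset.sum_mul, ite_mul, zero_mul]
    rw [Finset.sum_comm]
    refine Finset.sum_congr rfl fun k _ => ?_
    rw [Finset.sum_comm]
    refine Finset.sum_congr rfl fun l _ => ?_
    simp
  let J := ultraLim 𝒰 fun x => LinearMap.ker (evalMap (monomials₁₁ (a x) (c x)))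
  let I := ultraLim 𝒰 fun x => LinearMap.ker (evalMap (monomials₁₂ (a x) (c x)))
  let K := ultraLim 𝒰 fun x => LinearMap.ker (evalMap (monomials₀₂ (c x)))
  have hK : 12 ≤ Module.finrank ℂ K := le_finrank_ultraLim 𝒰 _ _ <| Eventually.of_forall fun x => by
    have h1 := card_le_finrank_ker_evalMap (monomials₀₂ (c x))
    have h2 : Fintype.card OrderedPair = 21 := by decide
    omega
  have hJ9 : 9 ≤ Module.finrank ℂ J := le_finrank_ultraLim 𝒰 _ _ <| Eventually.of_forall fun x => by
    have h1 := card_le_finrank_ker_evalMap (monomials₁₁ (a x) (c x))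
    simp only [Fintype.card_prod, Fintype.card_fin] at h1
    omega
  have hJs : J ≤ symCubic := by
    rintro F ⟨u, hu, hlim⟩
    refine mem_symCubic_of_annihilates fun i j => ?_
    have hlim' : ∀ y, Tendsto (fun x => u x y) 𝒰 (𝓝 (F y)) := tendsto_pi_nhds.1 hlim
    refine tendsto_nhds_unique (tendsto_finsetSum _ fun p _ => tendsto_finsetSum _ fun k _ =>
      tendsto_finsetSum _ fun l _ => (hlim' (p, pairIdx k l)).mul (h p i j k l)) ?_
    refine tendsto_const_nhds.congr fun x => ?_
    -- Before the limit the contraction is exactly zero, since `u x` vanishes at each of the nine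
    -- points.
    have hr : ∀ r, ∑ p, ∑ k, ∑ l, a x r p * (M x r k l * u x (p, pairIdx k l)) = 0 := by
      intro r
      have := congrFun (LinearMap.mem_ker.1 (hu x)) r
      simp only [evalMap_apply, monomials₁₁, Fintype.sum_prod_type, mul_assoc,
        ← Finset.mul_sum, hc x r fun v => u x (_, v)] at this
      rw [Pi.zero_apply] at this
      simpa only [← Finset.mul_sum] using this
    calc (0 : ℂ) = ∑ r, N x r i j *
          ∑ p, ∑ k, ∑ l, a x r p * (M x r k l * u x (p, pairIdx k l)) := by simp [hr]
      _ = ∑ r, ∑ p, ∑ k, ∑ l, u x (p, pairIdx k l) * (a x r p * (N x r i j * M x r k l)) := by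
          simp only [Finset.mul_sum]
          refine Finset.sum_congr rfl fun r _ => Finset.sum_congr rfl fun p _ =>
            Finset.sum_congr rfl fun k _ => Finset.sum_congr rfl fun l _ => ?_
          ring
      _ = _ := by
          rw [Finset.sum_comm]
          refine Finset.sum_congr rfl fun p _ => ?_
          rw [Finset.sum_comm]
          refine Finset.sum_congr rfl fun k _ => ?_
          rw [Finset.sum_comm]
          refine Finset.sum_congr rfl fun l _ => ?_
          rw [Finset.mul_sum]
  -- The ultrafilter decides the inequality. If it failed, the limit J would have dimension larger
  -- than its own.
  have hJd : ∀ᶠ x in 𝒰, Module.finrank ℂ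
      (LinearMap.ker (evalMap (monomials₁₁ (a x) (c x)))) ≤ Module.finrank ℂ J := by
    by_contra hne
    rw [← Ultrafilter.eventually_not] at hne
    have := le_finrank_ultraLim 𝒰 _ (Module.finrank ℂ J + 1) (hne.mono fun x hx => not_le.1 hx)
    exact absurd this (Nat.not_succ_le_self _)
  have hId : Module.finrank ℂ I ≤ 45 + Module.finrank ℂ J := finrank_ultraLim_le 𝒰 _ _
    (hJd.mono fun x hx => (finrank_ker_monomials₁₂_le (a x) (c x)).trans (by omega))
  let P : (Fin 6 → J) →ₗ[ℂ] (Fin 3 × OrderedPair → ℂ) :=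
    prolong ∘ₗ LinearMap.pi fun u => J.subtype ∘ₗ LinearMap.proj u
  have hPinj : Function.Injective P := by
    rw [← LinearMap.ker_eq_bot, LinearMap.ker_eq_bot']
    intro G hG
    have := eq_zero_of_prolong_eq_zero (G := fun u => (G u : Fin 3 × Fin 6 → ℂ))
      (fun u => hJs (G u).2) hG
    ext u : 2
    exact congrFun this u
  have hPI : LinearMap.range P ≤ I := by
    rintro _ ⟨G, rfl⟩
    choose u hu hlim using fun k => (G k).2
    refine ⟨fun x => prolong fun k => u k x, fun x => prolong_mem_ker _ _ fun k => hu k x, ?_⟩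
    exact (prolong.continuous_of_finiteDimensional.tendsto _).comp (tendsto_pi_nhds.2 hlim)
  have hPd : Module.finrank ℂ (LinearMap.range P) = 6 * Module.finrank ℂ J := by
    rw [LinearMap.finrank_range_of_inj hPinj, Module.finrank_pi_fintype]
    simp
  -- With d = dim J, the inequalities 6d ≤ dim I ≤ 45 + d and 9 ≤ d force d = 9 and dim I = 54, so
  -- the products of J fill I.
  have hle := Submodule.finrank_mono hPI
  have hPeq : LinearMap.range P = I := Submodule.eq_of_le_of_finrank_le hPI (by omega)
  have := finrank_le_nine_of_prolong J hJs (by omega) K fun Q hQ α => by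
    have hQI : mulCoord α Q ∈ I :=
      map_mem_ultraLim (mulCoord α) (fun x w hw => mulCoord_mem_ker (a x) (c x) α hw) hQ
    rw [← hPeq] at hQI
    obtain ⟨G, hG⟩ := hQI
    exact ⟨fun u => G u, fun u => (G u).2, hG⟩
  omega

end LowerBound
end

noncomputable section

/-! ### Schur modules as spaces of 3×3 matrices -/

section SchurCoordinates

variable {V : Type*} [AddCommGroup V] [Module ℂ V] (e : Module.Basis (Fin 3) ℂ V)

/-- The coordinates of a tensor. -/
def tensorCoord {lam : YoungDiagram} (f : lam.cells → Fin 3) : CellTensor lam V →ₗ[ℂ] ℂ :=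
  (Basis.piTensorProduct fun _ => e).coord f

theorem tensorCoord_tprod {lam : YoungDiagram} (f : lam.cells → Fin 3) (v : lam.cells → V) :
    tensorCoord e f (PiTensorProduct.tprod ℂ v) = ∏ x, e.repr (v x) (f x) :=
  Basis.piTensorProduct_repr_tprod_apply _ _ _

theorem ext_tensorCoord {lam : YoungDiagram} {x y : CellTensor lam V}
    (h : ∀ f, tensorCoord e f x = tensorCoord e f y) : x = y :=
  (Basis.piTensorProduct fun _ => e).ext_elem h

theorem exists_tensorCoord_eq {lam : YoungDiagram} (X : (lam.cells → Fin 3) → ℂ) :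
    ∃ x : CellTensor lam V, ∀ f, tensorCoord e f x = X f :=
  ⟨(Basis.piTensorProduct fun _ => e).equivFun.symm X, fun f =>
    congrFun ((Basis.piTensorProduct fun _ => e).equivFun.apply_symm_apply X) f⟩

theorem tensorCoord_reindex {lam : YoungDiagram} (f : lam.cells → Fin 3)
    (q : Equiv.Perm lam.cells) (x : CellTensor lam V) :
    tensorCoord e f (PiTensorProduct.reindex ℂ (fun _ => V) q x) = tensorCoord e (f ∘ q) x := by
  have : tensorCoord e f ∘ₗ (PiTensorProduct.reindex ℂ (fun _ : lam.cells => V) q).toLinearMap =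
      tensorCoord e (f ∘ q) := by
    ext v
    simp only [LinearMap.compMultilinearMap_apply, LinearMap.comp_apply, LinearEquiv.coe_coe,
      PiTensorProduct.reindex_tprod, tensorCoord_tprod]
    rw [← Equiv.prod_comp q]
    exact Finset.prod_congr rfl fun i _ => by rw [Equiv.symm_apply_apply, Function.comp_apply]
  exact LinearMap.congr_fun this x

theorem tensorCoord_youngSymmetrizer {lam : YoungDiagram} (f : lam.cells → Fin 3)
    (x : CellTensor lam V) :
    tensorCoord e f (youngSymmetrizer lam V x) = ∑ q ∈ colGroup lam,
      ((Equiv.Perm.sign q : ℤ) : ℂ) * ∑ p ∈ rowGroup lam, tensorCoord e (f ∘ q ∘ p) x := by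
  rw [youngSymmetrizer, LinearMap.comp_apply, LinearMap.sum_apply, map_sum]
  refine Finset.sum_congr rfl fun q _ => ?_
  rw [LinearMap.smul_apply, map_smul, LinearEquiv.coe_coe, tensorCoord_reindex,
    LinearMap.sum_apply, map_sum, smul_eq_mul]
  congr 1
  exact Finset.sum_congr rfl fun p _ => tensorCoord_reindex e _ p x

/-- A cell of the Young diagram of `(2,1)`. -/
abbrev cell21 (i j : ℕ) (h : (i, j) ∈ shape21.cells := by decide) : shape21.cells := ⟨(i, j), h⟩

/-- A cell of the Young diagram of `(2,2)`. -/
abbrev cell22 (i j : ℕ) (h : (i, j) ∈ shape22.cells := by decide) : shape22.cells := ⟨(i, j), h⟩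

theorem univ_cells21 :
    (Finset.univ : Finset shape21.cells) = {cell21 0 0, cell21 0 1, cell21 1 0} := by decide

theorem univ_cells22 : (Finset.univ : Finset shape22.cells) =
    {cell22 0 0, cell22 0 1, cell22 1 0, cell22 1 1} := by decide

theorem rowGroup21 : rowGroup shape21 = {1, Equiv.swap (cell21 0 0) (cell21 0 1)} := by
  decide +kernel

theorem colGroup21 : colGroup shape21 = {1, Equiv.swap (cell21 0 0) (cell21 1 0)} := by
  decide +kernel

theorem rowGroup22 : rowGroup shape22 = {1, Equiv.swap (cell22 0 0) (cell22 0 1),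
    Equiv.swap (cell22 1 0) (cell22 1 1),
    Equiv.swap (cell22 0 0) (cell22 0 1) * Equiv.swap (cell22 1 0) (cell22 1 1)} := by
  decide +kernel

theorem colGroup22 : colGroup shape22 = {1, Equiv.swap (cell22 0 0) (cell22 1 0),
    Equiv.swap (cell22 0 1) (cell22 1 1),
    Equiv.swap (cell22 0 0) (cell22 1 0) * Equiv.swap (cell22 0 1) (cell22 1 1)} := by
  decide +kernel

/-- The indexing of the cells of `(2,1)` with the given values. -/
def fill21 (p j r : Fin 3) (x : shape21.cells) : Fin 3 :=
  if x = cell21 0 0 then p else if x = cell21 0 1 then j else r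

/-- The indexing of the cells of `(2,2)` with the given values. -/
def fill22 (p q r s : Fin 3) (x : shape22.cells) : Fin 3 :=
  if x = cell22 0 0 then p else if x = cell22 0 1 then q else if x = cell22 1 0 then r else s

theorem forall_cells21 {P : shape21.cells → Prop} (h0 : P (cell21 0 0)) (h1 : P (cell21 0 1))
    (h2 : P (cell21 1 0)) (x : shape21.cells) : P x := by
  have := Finset.mem_univ x
  rw [univ_cells21] at this
  simp only [Finset.mem_insert, Finset.mem_singleton] at this
  obtain rfl | rfl | rfl := this <;> assumption

theorem forall_cells22 {P : shape22.cells → Prop} (h0 : P (cell22 0 0)) (h1 : P (cell22 0 1))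
    (h2 : P (cell22 1 0)) (h3 : P (cell22 1 1)) (x : shape22.cells) : P x := by
  have := Finset.mem_univ x
  rw [univ_cells22] at this
  simp only [Finset.mem_insert, Finset.mem_singleton] at this
  obtain rfl | rfl | rfl | rfl := this <;> assumption

theorem eq_fill21 (f : shape21.cells → Fin 3) :
    f = fill21 (f (cell21 0 0)) (f (cell21 0 1)) (f (cell21 1 0)) :=
  funext <| forall_cells21 rfl rfl rfl

theorem eq_fill22 (f : shape22.cells → Fin 3) :
    f = fill22 (f (cell22 0 0)) (f (cell22 0 1)) (f (cell22 1 0)) (f (cell22 1 1)) :=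
  funext <| forall_cells22 rfl rfl rfl rfl

theorem prod_cells21 (g : shape21.cells → ℂ) :
    ∏ x, g x = g (cell21 0 0) * (g (cell21 0 1) * g (cell21 1 0)) := by
  rw [univ_cells21, Finset.prod_insert (by decide), Finset.prod_insert (by decide),
    Finset.prod_singleton]

theorem prod_cells22 (g : shape22.cells → ℂ) :
    ∏ x, g x = g (cell22 0 0) * (g (cell22 0 1) * (g (cell22 1 0) * g (cell22 1 1))) := by
  rw [univ_cells22, Finset.prod_insert (by decide), Finset.prod_insert (by decide),
    Finset.prod_insert (by decide), Finset.prod_singleton]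

theorem tensorCoord_young21 (x : CellTensor shape21 V) (p j r : Fin 3) :
    tensorCoord e (fill21 p j r) (youngSymmetrizer shape21 V x) =
      tensorCoord e (fill21 p j r) x + tensorCoord e (fill21 j p r) x
        - tensorCoord e (fill21 r j p) x - tensorCoord e (fill21 j r p) x := by
  have e1 : fill21 p j r ∘ Equiv.swap (cell21 0 0) (cell21 0 1) = fill21 j p r :=
    funext <| forall_cells21 rfl rfl rfl
  have e2 : ∀ p j r, fill21 p j r ∘ Equiv.swap (cell21 0 0) (cell21 1 0) = fill21 r j p :=
    fun p j r => funext <| forall_cells21 rfl rfl rfl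
  have e3 : fill21 r j p ∘ Equiv.swap (cell21 0 0) (cell21 0 1) = fill21 j r p :=
    funext <| forall_cells21 rfl rfl rfl
  rw [tensorCoord_youngSymmetrizer, rowGroup21, colGroup21, Finset.sum_insert (by decide),
    Finset.sum_singleton, Finset.sum_insert (by decide), Finset.sum_singleton,
    Finset.sum_insert (by decide), Finset.sum_singleton, Equiv.Perm.sign_swap (by decide)]
  simp only [← Function.comp_assoc, Equiv.Perm.coe_one, Function.comp_id, e1, e2, e3,
    Equiv.Perm.sign_one]
  push_cast
  ring

/-- The effect of the row symmetrizer of `(2,2)` on coordinates. -/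
def rowSum22 (X : Fin 3 → Fin 3 → Fin 3 → Fin 3 → ℂ) (p q r s : Fin 3) : ℂ :=
  X p q r s + X q p r s + X p q s r + X q p s r

theorem tensorCoord_young22 (x : CellTensor shape22 V) (p q r s : Fin 3) :
    tensorCoord e (fill22 p q r s) (youngSymmetrizer shape22 V x) =
      rowSum22 (fun p q r s => tensorCoord e (fill22 p q r s) x) p q r s
        - rowSum22 (fun p q r s => tensorCoord e (fill22 p q r s) x) r q p s
        - rowSum22 (fun p q r s => tensorCoord e (fill22 p q r s) x) p s r q
        + rowSum22 (fun p q r s => tensorCoord e (fill22 p q r s) x) r s p q := by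
  have r1 : ∀ p q r s, fill22 p q r s ∘ Equiv.swap (cell22 0 0) (cell22 0 1) = fill22 q p r s :=
    fun p q r s => funext <| forall_cells22 rfl rfl rfl rfl
  have r2 : ∀ p q r s, fill22 p q r s ∘ Equiv.swap (cell22 1 0) (cell22 1 1) = fill22 p q s r :=
    fun p q r s => funext <| forall_cells22 rfl rfl rfl rfl
  have c1 : ∀ p q r s, fill22 p q r s ∘ Equiv.swap (cell22 0 0) (cell22 1 0) = fill22 r q p s :=
    fun p q r s => funext <| forall_cells22 rfl rfl rfl rfl
  have c2 : ∀ p q r s, fill22 p q r s ∘ Equiv.swap (cell22 0 1) (cell22 1 1) = fill22 p s r q :=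
    fun p q r s => funext <| forall_cells22 rfl rfl rfl rfl
  have hrow : ∀ p q r s,
      ∑ σ ∈ rowGroup shape22, tensorCoord e (fill22 p q r s ∘ σ) x =
        rowSum22 (fun p q r s => tensorCoord e (fill22 p q r s) x) p q r s := by
    intro p q r s
    rw [rowGroup22, Finset.sum_insert (by decide), Finset.sum_insert (by decide),
      Finset.sum_insert (by decide), Finset.sum_singleton]
    simp only [Equiv.Perm.coe_mul, ← Function.comp_assoc, Equiv.Perm.coe_one, Function.comp_id,
      r1, r2, rowSum22]
    ring
  rw [tensorCoord_youngSymmetrizer, colGroup22, Finset.sum_insert (by decide +kernel),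
    Finset.sum_insert (by decide +kernel), Finset.sum_insert (by decide +kernel),
    Finset.sum_singleton, Equiv.Perm.sign_mul, Equiv.Perm.sign_swap (by decide),
    Equiv.Perm.sign_swap (by decide)]
  simp only [Equiv.Perm.coe_mul, ← Function.comp_assoc, Equiv.Perm.coe_one, Function.comp_id,
    c1, c2, hrow, Equiv.Perm.sign_one]
  push_cast
  ring

/-- The identification of `S₍₂,₁₎` with traceless matrices, defined on the whole tensor power. -/
def coord21 : CellTensor shape21 V →ₗ[ℂ] (Fin 3 × Fin 3 → ℂ) :=
  LinearMap.pi fun x => tensorCoord e (fill21 (x.1 + 1) x.2 (x.1 + 2)) -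
    tensorCoord e (fill21 (x.1 + 2) x.2 (x.1 + 1))

/-- The identification of `S₍₂,₂₎` with symmetric matrices, defined on the whole tensor power. -/
def coord22 : CellTensor shape22 V →ₗ[ℂ] (Fin 3 × Fin 3 → ℂ) :=
  LinearMap.pi fun x => tensorCoord e (fill22 (x.1 + 1) (x.2 + 1) (x.1 + 2) (x.2 + 2)) -
    tensorCoord e (fill22 (x.1 + 1) (x.2 + 2) (x.1 + 2) (x.2 + 1)) -
    tensorCoord e (fill22 (x.1 + 2) (x.2 + 1) (x.1 + 1) (x.2 + 2)) +
    tensorCoord e (fill22 (x.1 + 2) (x.2 + 2) (x.1 + 1) (x.2 + 1))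

theorem coord21_apply (x : CellTensor shape21 V) (i j : Fin 3) :
    coord21 e x (i, j) = tensorCoord e (fill21 (i + 1) j (i + 2)) x -
      tensorCoord e (fill21 (i + 2) j (i + 1)) x := rfl

theorem coord22_apply (x : CellTensor shape22 V) (k l : Fin 3) :
    coord22 e x (k, l) = tensorCoord e (fill22 (k + 1) (l + 1) (k + 2) (l + 2)) x -
      tensorCoord e (fill22 (k + 1) (l + 2) (k + 2) (l + 1)) x -
      tensorCoord e (fill22 (k + 2) (l + 1) (k + 1) (l + 2)) x +
      tensorCoord e (fill22 (k + 2) (l + 2) (k + 1) (l + 1)) x := rfl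

/-- The trace is the total antisymmetrization, which kills the symmetrized row. -/
theorem coord21_trace (x : CellTensor shape21 V) :
    ∑ i, coord21 e (youngSymmetrizer shape21 V x) (i, i) = 0 := by
  simp only [coord21_apply, tensorCoord_young21, Fin.sum_univ_three, Fin.isValue, Fin.reduceAdd]
  ring

/-- Interchanging the two columns normalizes the column group, preserving signs, and lies in the row
group, so it fixes the image of the symmetrizer. -/
theorem coord22_comm (x : CellTensor shape22 V) (k l : Fin 3) :
    coord22 e (youngSymmetrizer shape22 V x) (k, l) =
      coord22 e (youngSymmetrizer shape22 V x) (l, k) := by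
  simp only [coord22_apply, tensorCoord_young22, rowSum22]
  ring

theorem eq_or_exists_cyclic (p r : Fin 3) :
    p = r ∨ ∃ i : Fin 3, p = i + 1 ∧ r = i + 2 ∨ p = i + 2 ∧ r = i + 1 := by
  revert p r; decide

theorem coord21_injective {x : CellTensor shape21 V}
    (hx : x ∈ LinearMap.range (youngSymmetrizer shape21 V)) (h : coord21 e x = 0) : x = 0 := by
  have hanti : ∀ p j r, tensorCoord e (fill21 p j r) x = -tensorCoord e (fill21 r j p) x := by
    obtain ⟨y, rfl⟩ := hx
    intro p j r
    simp only [tensorCoord_young21]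
    ring
  refine ext_tensorCoord e fun f => ?_
  rw [map_zero, eq_fill21 f]
  generalize f (cell21 0 0) = p, f (cell21 0 1) = j, f (cell21 1 0) = r
  obtain rfl | ⟨i, ⟨rfl, rfl⟩ | ⟨rfl, rfl⟩⟩ := eq_or_exists_cyclic p r
  · linear_combination (1 / 2 : ℂ) * hanti p j p
  · have h0 : coord21 e x (i, j) = 0 := congrFun h (i, j)
    rw [coord21_apply] at h0
    linear_combination (1 / 2 : ℂ) * h0 + (1 / 2 : ℂ) * hanti (i + 1) j (i + 2)
  · have h0 : coord21 e x (i, j) = 0 := congrFun h (i, j)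
    rw [coord21_apply] at h0
    linear_combination -(1 / 2 : ℂ) * h0 + (1 / 2 : ℂ) * hanti (i + 1) j (i + 2)

theorem coord22_injective {x : CellTensor shape22 V}
    (hx : x ∈ LinearMap.range (youngSymmetrizer shape22 V)) (h : coord22 e x = 0) : x = 0 := by
  have hanti : ∀ p q r s, tensorCoord e (fill22 p q r s) x =
      -tensorCoord e (fill22 r q p s) x := by
    obtain ⟨y, rfl⟩ := hx
    intro p q r s
    simp only [tensorCoord_young22]
    ring
  have hanti' : ∀ p q r s, tensorCoord e (fill22 p q r s) x =
      -tensorCoord e (fill22 p s r q) x := by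
    obtain ⟨y, rfl⟩ := hx
    intro p q r s
    simp only [tensorCoord_young22]
    ring
  have hcyc : ∀ k l : Fin 3,
      tensorCoord e (fill22 (k + 1) (l + 1) (k + 2) (l + 2)) x = 0 := by
    intro k l
    have h0 : coord22 e x (k, l) = 0 := congrFun h (k, l)
    rw [coord22_apply] at h0
    linear_combination (1 / 4 : ℂ) * h0 + (1 / 2 : ℂ) * hanti' (k + 1) (l + 1) (k + 2) (l + 2)
      + (1 / 4 : ℂ) * hanti (k + 1) (l + 1) (k + 2) (l + 2)
      - (1 / 4 : ℂ) * hanti (k + 1) (l + 2) (k + 2) (l + 1)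
  refine ext_tensorCoord e fun f => ?_
  rw [map_zero, eq_fill22 f]
  generalize f (cell22 0 0) = p, f (cell22 0 1) = q, f (cell22 1 0) = r, f (cell22 1 1) = s
  obtain rfl | ⟨k, hk⟩ := eq_or_exists_cyclic p r
  · linear_combination (1 / 2 : ℂ) * hanti p q p s
  obtain rfl | ⟨l, hl⟩ := eq_or_exists_cyclic q s
  · linear_combination (1 / 2 : ℂ) * hanti' p q r q
  obtain ⟨rfl, rfl⟩ | ⟨rfl, rfl⟩ := hk <;> obtain ⟨rfl, rfl⟩ | ⟨rfl, rfl⟩ := hl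
  · exact hcyc k l
  · rw [hanti', hcyc, neg_zero]
  · rw [hanti, hcyc, neg_zero]
  · rw [hanti, hanti', hcyc, neg_zero, neg_zero]

/-- The constant is 6 = 2 · 3: antisymmetrizing the column contributes 2, and the Young symmetrizer
acts on its image by the hook product 3. -/
theorem exists_coord21_eq (N : Fin 3 × Fin 3 → ℂ) (hN : ∑ i, N (i, i) = 0) :
    ∃ x ∈ LinearMap.range (youngSymmetrizer shape21 V), coord21 e x = N := by
  obtain ⟨y, hy⟩ := exists_tensorCoord_eq e fun f : shape21.cells → Fin 3 =>
    (1 / 6 : ℂ) * ∑ k, leviCivita k (f (cell21 0 0)) (f (cell21 1 0)) * N (k, f (cell21 0 1))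
  have hy' : ∀ p j r, tensorCoord e (fill21 p j r) y =
      (1 / 6 : ℂ) * ∑ k, leviCivita k p r * N (k, j) := fun p j r => hy _
  refine ⟨_, ⟨y, rfl⟩, funext fun ⟨i, j⟩ => ?_⟩
  rw [coord21_apply, tensorCoord_young21, tensorCoord_young21]
  simp only [hy']
  rw [Fin.sum_univ_three] at hN
  fin_cases i <;> fin_cases j <;>
    simp [Fin.sum_univ_three, leviCivita] <;>
    first | ring1 | linear_combination (-1 / 3 : ℂ) * hN

/-- The constant is 48 = 4 · 12: the two columns contribute 2 each, and the hook product of (2,2) is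
12. -/
theorem exists_coord22_eq (M : Fin 3 × Fin 3 → ℂ) (hM : ∀ k l, M (k, l) = M (l, k)) :
    ∃ x ∈ LinearMap.range (youngSymmetrizer shape22 V), coord22 e x = M := by
  obtain ⟨y, hy⟩ := exists_tensorCoord_eq e fun f : shape22.cells → Fin 3 =>
    (1 / 48 : ℂ) * ∑ k, leviCivita k (f (cell22 0 0)) (f (cell22 1 0)) *
      ∑ l, leviCivita l (f (cell22 0 1)) (f (cell22 1 1)) * M (k, l)
  have hy' : ∀ p q r s, tensorCoord e (fill22 p q r s) y =
      (1 / 48 : ℂ) * ∑ k, leviCivita k p r * ∑ l, leviCivita l q s * M (k, l) :=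
    fun p q r s => hy _
  refine ⟨_, ⟨y, rfl⟩, funext fun ⟨i, j⟩ => ?_⟩
  simp only [coord22_apply, tensorCoord_young22, rowSum22, hy']
  have h1 := hM 1 0
  have h2 := hM 2 0
  have h3 := hM 2 1
  fin_cases i <;> fin_cases j <;>
    simp [Fin.sum_univ_three, leviCivita, h1, h2, h3] <;> ring

end SchurCoordinates
end

noncomputable section

open scoped Kronecker

/-! ### The action of linear maps in matrix coordinates -/

section Action

variable {V : Type*} [AddCommGroup V] [Module ℂ V] (e : Module.Basis (Fin 3) ℂ V)

theorem repr_apply_eq_toMatrix (g : V →ₗ[ℂ] V) (v : V) (i : Fin 3) :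
    e.repr (g v) i = ∑ j, LinearMap.toMatrix e e g i j * e.repr v j := by
  rw [← LinearMap.toMatrix_mulVec_repr e e g v]
  rfl

/-- On an antisymmetrized column a linear map acts by its 2×2 minors, that is, by its cofactor
matrix. The cyclic indexing i+1, i+2 supplies the signs. -/
theorem coord21_map (g : V →ₗ[ℂ] V) (x : CellTensor shape21 V) :
    coord21 e (PiTensorProduct.map (fun _ => g) x) =
      ((LinearMap.toMatrix e e g).adjugate.transpose ⊗ₖ LinearMap.toMatrix e e g).mulVec
        (coord21 e x) := by
  have : coord21 e ∘ₗ PiTensorProduct.map (fun _ => g) = Matrix.mulVecLin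
      ((LinearMap.toMatrix e e g).adjugate.transpose ⊗ₖ LinearMap.toMatrix e e g) ∘ₗ
        coord21 e := by
    ext v ⟨i, j⟩
    simp only [LinearMap.compMultilinearMap_apply, LinearMap.comp_apply,
      PiTensorProduct.map_tprod, Matrix.mulVecLin_apply, Matrix.mulVec, dotProduct,
      Matrix.kroneckerMap_apply, Fintype.sum_prod_type, coord21_apply, tensorCoord_tprod,
      prod_cells21, repr_apply_eq_toMatrix e g, Matrix.transpose_apply, Matrix.adjugate_fin_three]
    generalize LinearMap.toMatrix e e g = H
    fin_cases i <;> fin_cases j <;> simp [Fin.sum_univ_three, fill21] <;> ring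
  exact LinearMap.congr_fun this x

theorem coord22_map (g : V →ₗ[ℂ] V) (x : CellTensor shape22 V) :
    coord22 e (PiTensorProduct.map (fun _ => g) x) =
      ((LinearMap.toMatrix e e g).adjugate.transpose ⊗ₖ
        (LinearMap.toMatrix e e g).adjugate.transpose).mulVec (coord22 e x) := by
  have : coord22 e ∘ₗ PiTensorProduct.map (fun _ => g) = Matrix.mulVecLin
      ((LinearMap.toMatrix e e g).adjugate.transpose ⊗ₖ
        (LinearMap.toMatrix e e g).adjugate.transpose) ∘ₗ coord22 e := by
    ext v ⟨i, j⟩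
    simp only [LinearMap.compMultilinearMap_apply, LinearMap.comp_apply,
      PiTensorProduct.map_tprod, Matrix.mulVecLin_apply, Matrix.mulVec, dotProduct,
      Matrix.kroneckerMap_apply, Fintype.sum_prod_type, coord22_apply, tensorCoord_tprod,
      prod_cells22, repr_apply_eq_toMatrix e g, Matrix.transpose_apply, Matrix.adjugate_fin_three]
    generalize LinearMap.toMatrix e e g = H
    fin_cases i <;> fin_cases j <;> simp [Fin.sum_univ_three, fill22] <;> ring
  exact LinearMap.congr_fun this x

end Action

/-! ### Dimensions of the Schur modules -/

section Dimensions

variable {V : Type*} [AddCommGroup V] [Module ℂ V]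

/-- The trace of a matrix. -/
def traceForm : (Fin 3 × Fin 3 → ℂ) →ₗ[ℂ] ℂ := ∑ i, LinearMap.proj (i, i)

theorem traceForm_apply (N : Fin 3 × Fin 3 → ℂ) : traceForm N = ∑ i, N (i, i) := by
  simp [traceForm]

theorem map_coord21_range (e : Module.Basis (Fin 3) ℂ V) :
    (LinearMap.range (youngSymmetrizer shape21 V)).map (coord21 e) = LinearMap.ker traceForm := by
  ext N
  rw [Submodule.mem_map, LinearMap.mem_ker, traceForm_apply]
  constructor
  · rintro ⟨_, ⟨y, rfl⟩, rfl⟩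
    exact coord21_trace e y
  · exact exists_coord21_eq e N

theorem finrank_schurModule21 (e : Module.Basis (Fin 3) ℂ V) :
    Module.finrank ℂ (SchurModule shape21 V) = 8 := by
  have hinj : Function.Injective ((coord21 e).domRestrict
      (LinearMap.range (youngSymmetrizer shape21 V))) := by
    rw [injective_iff_map_eq_zero]
    exact fun x hx => Subtype.ext (coord21_injective e x.2 hx)
  rw [← LinearMap.finrank_range_of_inj hinj, LinearMap.range_domRestrict, map_coord21_range]
  have h := traceForm.finrank_range_add_finrank_ker
  have hs : LinearMap.range traceForm = ⊤ := LinearMap.range_eq_top.2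
    (LinearMap.surjective fun h0 => by
      simpa [traceForm_apply, Pi.single_apply] using LinearMap.congr_fun h0 (Pi.single (0, 0) 1))
  rw [hs, finrank_top, Module.finrank_self] at h
  simp only [Module.finrank_fintype_fun_eq_card, Fintype.card_prod, Fintype.card_fin] at h
  omega

theorem map_coord22_range (e : Module.Basis (Fin 3) ℂ V) :
    (LinearMap.range (youngSymmetrizer shape22 V)).map (coord22 e) =
      LinearMap.range (LinearMap.funLeft ℂ ℂ fun x : Fin 3 × Fin 3 => pairIdx x.1 x.2) := by
  ext M
  rw [Submodule.mem_map]
  have key : M ∈ LinearMap.range (LinearMap.funLeft ℂ ℂ fun x : Fin 3 × Fin 3 => pairIdx x.1 x.2) ↔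
      ∀ k l, M (k, l) = M (l, k) := by
    constructor
    · rintro ⟨c, rfl⟩ k l
      exact congrArg c (pairIdx_comm k l)
    · refine fun h => ⟨![M (0, 0), M (0, 1), M (0, 2), M (1, 1), M (1, 2), M (2, 2)],
        funext fun ⟨k, l⟩ => ?_⟩
      have h1 := h 1 0
      have h2 := h 2 0
      have h3 := h 2 1
      fin_cases k <;> fin_cases l <;> first | rfl | exact h1.symm | exact h2.symm | exact h3.symm
  rw [key]
  constructor
  · rintro ⟨_, ⟨y, rfl⟩, rfl⟩
    exact coord22_comm e y
  · exact exists_coord22_eq e M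

theorem finrank_schurModule22 (e : Module.Basis (Fin 3) ℂ V) :
    Module.finrank ℂ (SchurModule shape22 V) = 6 := by
  have hinj : Function.Injective ((coord22 e).domRestrict
      (LinearMap.range (youngSymmetrizer shape22 V))) := by
    rw [injective_iff_map_eq_zero]
    exact fun x hx => Subtype.ext (coord22_injective e x.2 hx)
  have hsurj : Function.Surjective fun x : Fin 3 × Fin 3 => pairIdx x.1 x.2 := fun u =>
    let ⟨i, j, h⟩ := exists_pairIdx_eq u
    ⟨(i, j), h⟩
  rw [← LinearMap.finrank_range_of_inj hinj, LinearMap.range_domRestrict, map_coord22_range,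
    LinearMap.finrank_range_of_inj (LinearMap.funLeft_injective_of_surjective ℂ ℂ _ hsurj)]
  simp

end Dimensions

/-! ### Coordinates on threefold tensor products -/

section TensorCoordinates

variable {A B C : Type*} [AddCommMonoid A] [Module ℂ A] [AddCommMonoid B] [Module ℂ B]
  [AddCommMonoid C] [Module ℂ C] {κ₁ κ₂ κ₃ : Type*} [Fintype κ₁] [Fintype κ₂] [Fintype κ₃]
  (f : A →ₗ[ℂ] (κ₁ → ℂ)) (g : B →ₗ[ℂ] (κ₂ → ℂ)) (h : C →ₗ[ℂ] (κ₃ → ℂ))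

/-- The coordinates of a tensor with three factors in terms of coordinates of the factors. -/
def coordMap : A ⊗[ℂ] (B ⊗[ℂ] C) →ₗ[ℂ] (κ₁ × κ₂ × κ₃ → ℂ) :=
  (((Pi.basisFun ℂ κ₁).tensorProduct
    ((Pi.basisFun ℂ κ₂).tensorProduct (Pi.basisFun ℂ κ₃))).equivFun).toLinearMap ∘ₗ
      TensorProduct.map f (TensorProduct.map g h)

theorem coordMap_tmul (a : A) (b : B) (c : C) (x : κ₁) (y : κ₂) (z : κ₃) :
    coordMap f g h (a ⊗ₜ[ℂ] (b ⊗ₜ[ℂ] c)) (x, y, z) = f a x * (g b y * h c z) := by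
  simp only [coordMap, LinearMap.comp_apply, LinearEquiv.coe_coe, TensorProduct.map_tmul,
    Module.Basis.equivFun_apply, Module.Basis.tensorProduct_repr_tmul_apply, Pi.basisFun_repr,
    smul_eq_mul]
  ring

theorem coordMap_injective [Module.Flat ℂ B] [Module.Flat ℂ C]
    (hf : Function.Injective f) (hg : Function.Injective g)
    (hh : Function.Injective h) : Function.Injective (coordMap f g h) :=
  (((Pi.basisFun ℂ κ₁).tensorProduct
    ((Pi.basisFun ℂ κ₂).tensorProduct (Pi.basisFun ℂ κ₃))).equivFun).injective.comp
    (TensorProduct.map_injective_of_flat_flat _ _ hf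
      (TensorProduct.map_injective_of_flat_flat _ _ hg hh))

theorem coordMap_map {ρ : A →ₗ[ℂ] A} {σ : B →ₗ[ℂ] B} {τ : C →ₗ[ℂ] C} {P : Matrix κ₁ κ₁ ℂ}
    {Q : Matrix κ₂ κ₂ ℂ} {R : Matrix κ₃ κ₃ ℂ} (hf : ∀ a, f (ρ a) = P.mulVec (f a))
    (hg : ∀ b, g (σ b) = Q.mulVec (g b)) (hh : ∀ c, h (τ c) = R.mulVec (h c))
    (X : A ⊗[ℂ] (B ⊗[ℂ] C)) :
    coordMap f g h (TensorProduct.map ρ (TensorProduct.map σ τ) X) =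
      (P ⊗ₖ (Q ⊗ₖ R)).mulVec (coordMap f g h X) := by
  have : coordMap f g h ∘ₗ TensorProduct.map ρ (TensorProduct.map σ τ) =
      Matrix.mulVecLin (P ⊗ₖ (Q ⊗ₖ R)) ∘ₗ coordMap f g h := by
    ext a b c ⟨x, y, z⟩
    simp only [TensorProduct.AlgebraTensorModule.curry_apply, LinearMap.restrictScalars_self,
      TensorProduct.curry_apply, LinearMap.comp_apply, TensorProduct.map_tmul, coordMap_tmul,
      Matrix.mulVecLin_apply, Matrix.mulVec, dotProduct, hf, hg, hh, Fintype.sum_prod_type,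
      Matrix.kroneckerMap_apply]
    rw [Finset.sum_mul]
    refine Finset.sum_congr rfl fun x' _ => ?_
    rw [Finset.sum_mul, Finset.mul_sum]
    refine Finset.sum_congr rfl fun y' _ => ?_
    rw [Finset.mul_sum, Finset.mul_sum]
    exact Finset.sum_congr rfl fun z' _ => by ring
  exact LinearMap.congr_fun this X

end TensorCoordinates
end

noncomputable section

/-! ### Existence and uniqueness of the invariant in coordinates -/

section InvariantCoordinates

open scoped Kronecker

/-- The index set of the coordinates of `(ℂ³)* ⊗ S₍₂,₁₎(ℂ³)* ⊗ S₍₂,₂₎ℂ³`. -/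
abbrev CoordIndex : Type := Fin 3 × (Fin 3 × Fin 3) × (Fin 3 × Fin 3)

/-- The coordinates of the invariant tensor, as a vector. -/
def invariantVec : CoordIndex → ℂ := fun x => invariantCoord x.1 x.2.1.1 x.2.1.2 x.2.2.1 x.2.2.2

/-- The action of a linear map on coordinates, up to a power of the determinant. -/
def actionMatrix (G H : Matrix (Fin 3) (Fin 3) ℂ) : Matrix CoordIndex CoordIndex ℂ :=
  H ⊗ₖ ((G ⊗ₖ H) ⊗ₖ (H ⊗ₖ H))

theorem actionMatrix_mulVec (G H : Matrix (Fin 3) (Fin 3) ℂ) (X : CoordIndex → ℂ)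
    (a i j k l : Fin 3) : (actionMatrix G H).mulVec X (a, (i, j), (k, l)) =
      ∑ a', ∑ i', ∑ j', ∑ k', ∑ l', H a a' * (G i i' * H j j' * (H k k' * H l l')) *
        X (a', (i', j'), (k', l')) := by
  simp only [actionMatrix, Matrix.mulVec, dotProduct, Fintype.sum_prod_type,
    Matrix.kroneckerMap_apply]

theorem sum_mul_invariantCoord (x y z u w : Fin 3 → ℂ) :
    ∑ a, ∑ i, ∑ j, ∑ k, ∑ l, x a * (y i * z j * (u k * w l)) * invariantCoord a i j k l =
      (∑ i, y i * u i) * (∑ a, ∑ j, ∑ l, x a * z j * w l * leviCivita a j l) +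
        (∑ i, y i * w i) * (∑ a, ∑ j, ∑ k, x a * z j * u k * leviCivita a j k) := by
  simp [Fin.sum_univ_three, invariantCoord, leviCivita]
  ring

theorem sum_mul_leviCivita (H : Matrix (Fin 3) (Fin 3) ℂ) (a j l : Fin 3) :
    ∑ a', ∑ j', ∑ l', H a a' * H j j' * H l l' * leviCivita a' j' l' =
      H.det * leviCivita a j l := by
  rw [Matrix.det_fin_three]
  fin_cases a <;> fin_cases j <;> fin_cases l <;> simp [Fin.sum_univ_three, leviCivita] <;> ring

/-- G and H are inverse transposes, so the delta is preserved, while the Levi-Civita symbol is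
multiplied by det H. -/
theorem actionMatrix_mulVec_invariantVec {G H : Matrix (Fin 3) (Fin 3) ℂ}
    (hGH : G * H.transpose = 1) :
    (actionMatrix G H).mulVec invariantVec = H.det • invariantVec := by
  have h1 : ∀ i k, ∑ i', G i i' * H k i' = if i = k then 1 else 0 := fun i k => by
    rw [← Matrix.one_apply, ← hGH, Matrix.mul_apply]
    rfl
  ext ⟨a, ⟨i, j⟩, k, l⟩
  rw [actionMatrix_mulVec]
  refine (sum_mul_invariantCoord (H a) (G i) (H j) (H k) (H l)).trans ?_
  rw [sum_mul_leviCivita, sum_mul_leviCivita, h1, h1]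
  simp only [invariantVec, invariantCoord, Pi.smul_apply, smul_eq_mul]
  split_ifs <;> ring

/-- The weights of a diagonal matrix. -/
def weight : Fin 3 → ℕ := ![1, 2, 5]

/-- Invariance under H = diag(1, 2, 5) with G = H⁻¹ scales each coordinate by its weight, where det
G = 1/10. This single torus element separates all the weights that are needed. -/
theorem eq_zero_of_weight_ne {X : CoordIndex → ℂ}
    (hX : ∀ G H : Matrix (Fin 3) (Fin 3) ℂ, G * H.transpose = 1 →
      X = G.det • (actionMatrix G H).mulVec X) {a i j k l : Fin 3}
    (h : 10 * weight i ≠ weight a * weight j * weight k * weight l) :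
    X (a, (i, j), (k, l)) = 0 := by
  have hw : ∀ i, (weight i : ℂ) ≠ 0 := by
    intro i
    fin_cases i <;> simp [weight]
  have h0 := congrFun (hX (Matrix.diagonal fun i => (weight i : ℂ)⁻¹)
    (Matrix.diagonal fun i => (weight i : ℂ)) (by
      rw [Matrix.diagonal_transpose, Matrix.diagonal_mul_diagonal, ← Matrix.diagonal_one]
      exact congrArg _ (funext fun i => inv_mul_cancel₀ (hw i)))) (a, (i, j), (k, l))
  rw [Pi.smul_apply, actionMatrix_mulVec, Matrix.det_diagonal] at h0
  simp only [Matrix.diagonal_apply, ite_mul, mul_ite, zero_mul, mul_zero, Finset.sum_ite_eq,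
    Finset.mem_univ, if_true, smul_eq_mul] at h0
  have hp : ∏ i, (weight i : ℂ)⁻¹ = 10⁻¹ := by
    simp [Fin.prod_univ_three, weight]
    norm_num
  rw [hp] at h0
  have h1 : ((10 * weight i : ℕ) : ℂ) ≠ (weight a * weight j * weight k * weight l : ℕ) :=
    Nat.cast_injective.ne h
  push_cast at h1
  have h2 := hw i
  field_simp at h0
  by_contra hne
  exact h1 (mul_right_cancel₀ hne (by linear_combination h0))

/-- View X as a matrix-valued form, linear in a vector x and quadratic in a vector y. Invariance
carries its value at (e₀, e₁) to its value at the first two rows of H, up to invertible factors, so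
vanishing at one independent pair spreads to all of them. -/
theorem sum_eq_zero_of_invariant {X : CoordIndex → ℂ}
    (hX : ∀ G H : Matrix (Fin 3) (Fin 3) ℂ, G * H.transpose = 1 →
      X = G.det • (actionMatrix G H).mulVec X) (h : ∀ i j, X (0, (i, j), (1, 1)) = 0)
    {H : Matrix (Fin 3) (Fin 3) ℂ} (hH : H.det ≠ 0) (i j : Fin 3) :
    ∑ a, ∑ k, ∑ l, H 0 a * (H 1 k * H 1 l) * X (a, (i, j), (k, l)) = 0 := by
  have hu : IsUnit H.det := isUnit_iff_ne_zero.2 hH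
  set G := H⁻¹.transpose with hG
  have h1 : G * H.transpose = 1 := by
    rw [hG, ← Matrix.transpose_mul, Matrix.mul_nonsing_inv _ hu, Matrix.transpose_one]
  have h2 : H.transpose * G = 1 := by
    rw [hG, ← Matrix.transpose_mul, Matrix.nonsing_inv_mul _ hu, Matrix.transpose_one]
  have hdet : G.det ≠ 0 := fun h0 => by
    simpa [Matrix.det_mul, h0] using congrArg Matrix.det h1
  let S : Matrix (Fin 3) (Fin 3) ℂ := Matrix.of fun i j =>
    ∑ a, ∑ k, ∑ l, H 0 a * (H 1 k * H 1 l) * X (a, (i, j), (k, l))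
  have hS : G * S * H.transpose = 0 := by
    ext i j
    have h3 := congrFun (hX G H h1) (0, (i, j), (1, 1))
    rw [h, Pi.smul_apply, actionMatrix_mulVec, smul_eq_mul] at h3
    have h4 := (mul_eq_zero.1 h3.symm).resolve_left hdet
    rw [Matrix.zero_apply, ← h4]
    simp only [S, Matrix.mul_apply, Matrix.of_apply, Matrix.transpose_apply, Fin.sum_univ_three]
    ring
  have : S = 0 := by
    calc S = (H.transpose * G) * S * (H.transpose * G) := by rw [h2, one_mul, mul_one]
      _ = H.transpose * (G * S * H.transpose) * G := by simp only [mul_assoc]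
      _ = 0 := by rw [hS, mul_zero, zero_mul]
  exact congrFun (congrFun this i) j

theorem eq_zero_of_invariant {X : CoordIndex → ℂ}
    (hX : ∀ G H : Matrix (Fin 3) (Fin 3) ℂ, G * H.transpose = 1 →
      X = G.det • (actionMatrix G H).mulVec X)
    (hs : ∀ a i j k l, X (a, (i, j), (k, l)) = X (a, (i, j), (l, k)))
    (h : ∀ i j, X (0, (i, j), (1, 1)) = 0) : X = 0 := by
  have hdiag : ∀ a i j, X (a, (i, j), (a, a)) = 0 := fun a i j =>
    eq_zero_of_weight_ne hX (by revert a i j; decide)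
  have key : ∀ a k m : Fin 3, a ≠ k → a ≠ m → k ≠ m → ∀ i j, ∀ c d : ℂ,
      X (a, (i, j), (k, k)) + c ^ 2 * X (a, (i, j), (m, m)) + 2 * c * X (a, (i, j), (k, m)) +
        2 * d * X (a, (i, j), (k, a)) + 2 * (c * d) * X (a, (i, j), (m, a)) = 0 := by
    intro a k m hak ham hkm i j c d
    -- The pair x = e_a, y = e_k + c e_m + d e_a; varying c and d isolates the coefficients of the
    -- form.
    have h0 := sum_eq_zero_of_invariant hX h (H := Matrix.of ![Pi.single a 1,
      Pi.single k 1 + Pi.single m c + Pi.single a d, Pi.single m 1]) (by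
        rw [Matrix.det_fin_three]
        fin_cases a <;> fin_cases k <;> fin_cases m <;> simp at hak ham hkm ⊢) i j
    simp only [Matrix.of_apply, Matrix.cons_val_zero, Matrix.cons_val_one, Pi.single_apply,
      Pi.add_apply, ite_mul, mul_ite, add_mul, mul_add, one_mul, mul_one, zero_mul, mul_zero,
      Finset.sum_add_distrib, Finset.sum_ite_eq', Finset.mem_univ, if_true] at h0
    linear_combination h0 - d ^ 2 * hdiag a i j + d * hs a i j k a + c * hs a i j k m
      + c * d * hs a i j m a
  have hkk : ∀ a k : Fin 3, a ≠ k → ∀ i j, X (a, (i, j), (k, k)) = 0 := by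
    intro a k hak i j
    obtain ⟨m, ham, hkm⟩ : ∃ m, a ≠ m ∧ k ≠ m := by revert a k; decide
    simpa using key a k m hak ham hkm i j 0 0
  have hka : ∀ a k : Fin 3, a ≠ k → ∀ i j, X (a, (i, j), (k, a)) = 0 := by
    intro a k hak i j
    obtain ⟨m, ham, hkm⟩ : ∃ m, a ≠ m ∧ k ≠ m := by revert a k; decide
    linear_combination (1 / 2 : ℂ) * key a k m hak ham hkm i j 0 1 -
      (1 / 2 : ℂ) * hkk a k hak i j
  ext ⟨a, ⟨i, j⟩, k, l⟩
  rw [Pi.zero_apply]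
  by_cases hak : a = k
  · by_cases hal : a = l
    · subst hak hal
      exact hdiag a i j
    · subst hak
      rw [hs]
      exact hka a l hal i j
  by_cases hal : a = l
  · subst hal
    exact hka a k hak i j
  by_cases hkl : k = l
  · subst hkl
    exact hkk a k hak i j
  linear_combination (1 / 2 : ℂ) * key a k l hak hal hkl i j 1 0 -
    (1 / 2 : ℂ) * hkk a k hak i j - (1 / 2 : ℂ) * hkk a l hal i j

theorem eq_smul_invariantVec {X : CoordIndex → ℂ}
    (hX : ∀ G H : Matrix (Fin 3) (Fin 3) ℂ, G * H.transpose = 1 →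
      X = G.det • (actionMatrix G H).mulVec X)
    (hs : ∀ a i j k l, X (a, (i, j), (k, l)) = X (a, (i, j), (l, k))) :
    ∃ c : ℂ, X = c • invariantVec := by
  -- By weights, (1, 2) is the only position of the slice (0, ·, (1, 1)) that can be nonzero, and
  -- the invariant has the value -2 there.
  refine ⟨-X (0, (1, 2), (1, 1)) / 2, sub_eq_zero.1 (eq_zero_of_invariant ?_ ?_ ?_)⟩
  · intro G H hGH
    have hdet : G.det * H.det = 1 := by
      simpa [Matrix.det_mul] using congrArg Matrix.det hGH
    rw [Matrix.mulVec_sub, Matrix.mulVec_smul, actionMatrix_mulVec_invariantVec hGH, smul_sub,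
      ← hX G H hGH, smul_comm G.det, smul_smul G.det, hdet, one_smul]
  · intro a i j k l
    simp only [Pi.sub_apply, Pi.smul_apply, hs a i j k l, invariantVec, invariantCoord,
      add_comm (if i = k then leviCivita a j l else 0)]
  · intro i j
    rw [Pi.sub_apply, Pi.smul_apply, sub_eq_zero]
    by_cases hij : i = 1 ∧ j = 2
    · obtain ⟨rfl, rfl⟩ := hij
      simp [invariantVec, invariantCoord, leviCivita]
      ring
    · rw [eq_zero_of_weight_ne hX (by revert i j; decide)]
      have : invariantVec (0, (i, j), (1, 1)) = 0 := by
        revert hij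
        fin_cases i <;> fin_cases j <;> simp [invariantVec, invariantCoord, leviCivita]
      rw [this, smul_zero]

end InvariantCoordinates
end

noncomputable section

/-! ### The invariant tensor in the representation, and its border rank -/

section InvariantTensor

open Filter Topology
open scoped Kronecker

/-- The dual of the standard basis of `ℂ³`. -/
abbrev dualBasisC3 : Module.Basis (Fin 3) ℂ (Module.Dual ℂ C3) :=
  (Pi.basisFun ℂ (Fin 3)).dualBasis

/-- The coordinates of a vector of `(ℂ³)*`. -/
def dualCoord : Module.Dual ℂ C3 →ₗ[ℂ] (Fin 3 → ℂ) := dualBasisC3.equivFun.toLinearMap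

/-- The coordinates of a vector of `S₍₂,₁₎(ℂ³)*`. -/
def schurCoord21 : SchurModule shape21 (Module.Dual ℂ C3) →ₗ[ℂ] (Fin 3 × Fin 3 → ℂ) :=
  (coord21 dualBasisC3).domRestrict _

/-- The coordinates of a vector of `S₍₂,₂₎ℂ³`. -/
def schurCoord22 : SchurModule shape22 C3 →ₗ[ℂ] (Fin 3 × Fin 3 → ℂ) :=
  (coord22 (Pi.basisFun ℂ (Fin 3))).domRestrict _

/-- The coordinates of a tensor in `(ℂ³)* ⊗ S₍₂,₁₎(ℂ³)* ⊗ S₍₂,₂₎ℂ³`. -/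
def spaceCoord : TensorSpace →ₗ[ℂ] (CoordIndex → ℂ) :=
  coordMap dualCoord schurCoord21 schurCoord22

theorem Module.flat_of_complex (V : Type*) [AddCommGroup V] [Module ℂ V] : Module.Flat ℂ V :=
  inferInstance

theorem flat_schurModule (lam : YoungDiagram) (V : Type*) [AddCommGroup V] [Module ℂ V] :
    Module.Flat ℂ (SchurModule lam V) :=
  Module.flat_of_complex (SchurModule lam V)

theorem spaceCoord_injective : Function.Injective spaceCoord := by
  have := flat_schurModule shape21 (Module.Dual ℂ C3)
  have := flat_schurModule shape22 C3
  refine coordMap_injective _ _ _ dualBasisC3.equivFun.injective ?_ ?_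
  · rw [injective_iff_map_eq_zero]
    exact fun x hx => Subtype.ext (coord21_injective _ x.2 hx)
  · rw [injective_iff_map_eq_zero]
    exact fun x hx => Subtype.ext (coord22_injective _ x.2 hx)

theorem spaceCoord_comm (X : TensorSpace) (a i j k l : Fin 3) :
    spaceCoord X (a, (i, j), (k, l)) = spaceCoord X (a, (i, j), (l, k)) := by
  have hc : ∀ c, schurCoord22 c (k, l) = schurCoord22 c (l, k) := by
    rintro ⟨_, y, rfl⟩
    exact coord22_comm _ y k l
  induction X using TensorProduct.induction_on with
  | zero => simp only [map_zero, Pi.zero_apply]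
  | add X Y hX hY => simp only [map_add, Pi.add_apply, hX, hY]
  | tmul x z =>
    induction z using TensorProduct.induction_on with
    | zero => simp only [TensorProduct.tmul_zero, map_zero, Pi.zero_apply]
    | add X Y hX hY => simp only [TensorProduct.tmul_add, map_add, Pi.add_apply, hX, hY]
    | tmul y z => simp only [spaceCoord, coordMap_tmul, hc]

/-- The coordinate array is traceless in i, j, since the two Levi-Civita terms cancel, and symmetric
in k, l. It is therefore expanded along symmetrized matrix units. -/
theorem exists_spaceCoord_eq : ∃ T : TensorSpace, spaceCoord T = invariantVec := by
  have h21 : ∀ a k l, ∃ b, schurCoord21 b = fun x => invariantCoord a x.1 x.2 k l := by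
    intro a k l
    obtain ⟨b, hb, h⟩ := exists_coord21_eq dualBasisC3
      (fun x => invariantCoord a x.1 x.2 k l) (by
        fin_cases a <;> fin_cases k <;> fin_cases l <;>
          simp [Fin.sum_univ_three, invariantCoord, leviCivita])
    exact ⟨⟨b, hb⟩, h⟩
  have h22 : ∀ k l, ∃ c, schurCoord22 c = fun x =>
      ((if k = x.1 then if l = x.2 then 1 / 2 else 0 else 0) +
        if l = x.1 then if k = x.2 then 1 / 2 else 0 else 0 : ℂ) := by
    intro k l
    obtain ⟨c, hc, h⟩ := exists_coord22_eq (Pi.basisFun ℂ (Fin 3)) (fun x =>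
      ((if k = x.1 then if l = x.2 then 1 / 2 else 0 else 0) +
        if l = x.1 then if k = x.2 then 1 / 2 else 0 else 0 : ℂ)) (by
        intro k' l'
        dsimp only
        split_ifs <;> simp)
    exact ⟨⟨c, hc⟩, h⟩
  choose b hb using h21
  choose c hc using h22
  refine ⟨∑ a, ∑ k, ∑ l, dualBasisC3 a ⊗ₜ[ℂ] (b a k l ⊗ₜ[ℂ] c k l), ?_⟩
  have ha : ∀ a a', dualCoord (dualBasisC3 a) a' = if a = a' then 1 else 0 := fun a a' =>
    dualBasisC3.equivFun_self a a'
  ext ⟨a, ⟨i, j⟩, k, l⟩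
  simp only [map_sum, Finset.sum_apply, spaceCoord, coordMap_tmul, ha, hb, hc, ite_mul, one_mul,
    zero_mul, mul_add, mul_ite, mul_zero, Finset.sum_add_distrib, Finset.sum_ite_eq',
    Finset.mem_univ, if_true, Finset.sum_ite_irrel, Finset.sum_const_zero, invariantVec,
    invariantCoord]
  split_ifs <;> ring

theorem adjugate_transpose_of_mul_eq_one {G H : Matrix (Fin 3) (Fin 3) ℂ}
    (h : G * H.transpose = 1) :
    G.adjugate.transpose = G.det • H := by
  have h1 : G.adjugate = G.det • H.transpose := by
    calc G.adjugate = G.adjugate * (G * H.transpose) := by rw [h, mul_one]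
      _ = G.det • H.transpose := by rw [← mul_assoc, Matrix.adjugate_mul, smul_mul_assoc, one_mul]
  rw [h1, Matrix.transpose_smul, Matrix.transpose_transpose]

theorem toMatrix'_mul_toMatrix'_inv (g : GL3) : LinearMap.toMatrix' (g : C3 →ₗ[ℂ] C3) *
    LinearMap.toMatrix' ((g⁻¹ : GL3) : C3 →ₗ[ℂ] C3) = 1 := by
  rw [← LinearMap.toMatrix'_mul, ← Units.val_mul, mul_inv_cancel, Units.val_one,
    LinearMap.toMatrix'_one]

/-- The matrix of the action of `g` on `(ℂ³)*`. -/
def dualMatrix (g : GL3) : Matrix (Fin 3) (Fin 3) ℂ :=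
  (LinearMap.toMatrix' ((g⁻¹ : GL3) : C3 →ₗ[ℂ] C3)).transpose

theorem toMatrix'_mul_dualMatrix (g : GL3) :
    LinearMap.toMatrix' (g : C3 →ₗ[ℂ] C3) * (dualMatrix g).transpose = 1 := by
  rw [dualMatrix, Matrix.transpose_transpose, toMatrix'_mul_toMatrix'_inv]

theorem dualMatrix_mul_toMatrix' (g : GL3) :
    dualMatrix g * (LinearMap.toMatrix' (g : C3 →ₗ[ℂ] C3)).transpose = 1 := by
  rw [← Matrix.transpose_one, ← toMatrix'_mul_dualMatrix g, Matrix.transpose_mul,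
    Matrix.transpose_transpose]

theorem det_toMatrix'_mul_det_dualMatrix (g : GL3) :
    (LinearMap.toMatrix' (g : C3 →ₗ[ℂ] C3)).det * (dualMatrix g).det = 1 := by
  simpa only [Matrix.det_mul, Matrix.det_transpose, Matrix.det_one] using
    congrArg Matrix.det (toMatrix'_mul_dualMatrix g)

theorem toMatrix_dual_stdRep (g : GL3) :
    LinearMap.toMatrix dualBasisC3 dualBasisC3 (stdRep.dual g) = dualMatrix g :=
  LinearMap.toMatrix_transpose _

theorem dualCoord_dual (g : GL3) (a : Module.Dual ℂ C3) :
    dualCoord (stdRep.dual g a) = (dualMatrix g).mulVec (dualCoord a) := by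
  rw [← toMatrix_dual_stdRep]
  exact (LinearMap.toMatrix_mulVec_repr dualBasisC3 dualBasisC3 (stdRep.dual g) a).symm

theorem schurCoord21_schurRep (g : GL3) (b : SchurModule shape21 (Module.Dual ℂ C3)) :
    schurCoord21 (schurRep shape21 stdRep.dual g b) =
      (((dualMatrix g).det • LinearMap.toMatrix' (g : C3 →ₗ[ℂ] C3)) ⊗ₖ dualMatrix g).mulVec
        (schurCoord21 b) := by
  rw [← adjugate_transpose_of_mul_eq_one (dualMatrix_mul_toMatrix' g), ← toMatrix_dual_stdRep]
  exact coord21_map dualBasisC3 (stdRep.dual g) b.1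

theorem schurCoord22_schurRep (g : GL3) (c : SchurModule shape22 C3) :
    schurCoord22 (schurRep shape22 stdRep g c) =
      (((LinearMap.toMatrix' (g : C3 →ₗ[ℂ] C3)).det • dualMatrix g) ⊗ₖ
        ((LinearMap.toMatrix' (g : C3 →ₗ[ℂ] C3)).det • dualMatrix g)).mulVec
          (schurCoord22 c) := by
  rw [← adjugate_transpose_of_mul_eq_one (toMatrix'_mul_dualMatrix g)]
  exact coord22_map (Pi.basisFun ℂ (Fin 3)) (stdRep g) c.1

/-- The determinant factors are det H from S₍₂,₁₎ of the dual and (det G)² from S₍₂,₂₎; their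
product is det G. -/
theorem kronecker_eq_smul_actionMatrix {G H : Matrix (Fin 3) (Fin 3) ℂ}
    (hdet : G.det * H.det = 1) :
    H ⊗ₖ (((H.det • G) ⊗ₖ H) ⊗ₖ ((G.det • H) ⊗ₖ (G.det • H))) = G.det • actionMatrix G H := by
  ext ⟨a, ⟨i, j⟩, k, l⟩ ⟨a', ⟨i', j'⟩, k', l'⟩
  simp only [actionMatrix, Matrix.kroneckerMap_apply, Matrix.smul_apply, smul_eq_mul]
  linear_combination (H a a' * (G i i' * H j j' * (H k k' * H l l'))) * G.det * hdet

theorem spaceCoord_tensorRep (g : GL3) (X : TensorSpace) :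
    spaceCoord (tensorRep g X) = (LinearMap.toMatrix' (g : C3 →ₗ[ℂ] C3)).det •
      (actionMatrix (LinearMap.toMatrix' (g : C3 →ₗ[ℂ] C3)) (dualMatrix g)).mulVec
        (spaceCoord X) := by
  have hmap := coordMap_map (ρ := stdRep.dual g) (σ := schurRep shape21 stdRep.dual g)
    (τ := schurRep shape22 stdRep g) dualCoord schurCoord21 schurCoord22 (dualCoord_dual g)
    (schurCoord21_schurRep g) (schurCoord22_schurRep g) X
  rw [← Matrix.smul_mulVec, ← kronecker_eq_smul_actionMatrix (det_toMatrix'_mul_det_dualMatrix g),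
    tensorRep, Representation.tprod_apply, Representation.tprod_apply]
  exact hmap

theorem invariants_eq_span {T : TensorSpace} (hT : spaceCoord T = invariantVec) :
    tensorRep.invariants = Submodule.span ℂ {T} := by
  refine le_antisymm (fun X hX => ?_) ?_
  · have hinv : ∀ G H : Matrix (Fin 3) (Fin 3) ℂ, G * H.transpose = 1 →
        spaceCoord X = G.det • (actionMatrix G H).mulVec (spaceCoord X) := by
      intro G H hGH
      have hHG : H.transpose * G = 1 := mul_eq_one_comm.1 hGH
      let g : GL3 := ⟨Matrix.toLin' G, Matrix.toLin' H.transpose,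
        by rw [Module.End.mul_eq_comp, ← Matrix.toLin'_mul, hGH, Matrix.toLin'_one]; rfl,
        by rw [Module.End.mul_eq_comp, ← Matrix.toLin'_mul, hHG, Matrix.toLin'_one]; rfl⟩
      have h1 := spaceCoord_tensorRep g X
      have h2 : LinearMap.toMatrix' (g : C3 →ₗ[ℂ] C3) = G := LinearMap.toMatrix'_toLin' G
      have h3 : dualMatrix g = H :=
        congrArg Matrix.transpose (LinearMap.toMatrix'_toLin' H.transpose)
      rwa [h2, h3,
        (Representation.mem_invariants tensorRep X).1 hX g] at h1
    obtain ⟨c, hc⟩ := eq_smul_invariantVec hinv (spaceCoord_comm X)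
    rw [← hT, ← map_smul] at hc
    exact Submodule.mem_span_singleton.2 ⟨c, (spaceCoord_injective hc).symm⟩
  · rw [Submodule.span_singleton_le_iff_mem, Representation.mem_invariants]
    intro g
    refine spaceCoord_injective ?_
    rw [spaceCoord_tensorRep, hT, actionMatrix_mulVec_invariantVec (toMatrix'_mul_dualMatrix g),
      smul_smul, det_toMatrix'_mul_det_dualMatrix, one_smul]

theorem notMem_borderRankLE_nine {T : TensorSpace} (hT : spaceCoord T = invariantVec) :
    T ∉ borderRankLE (Module.Dual ℂ C3) (SchurModule shape21 (Module.Dual ℂ C3))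
      (SchurModule shape22 C3) 9 := by
  let _ : TopologicalSpace TensorSpace := moduleTopology ℂ TensorSpace
  intro h
  obtain ⟨𝒰, h𝒰, hle⟩ := mem_closure_iff_ultrafilter.1 h
  -- Tensors outside the rank locus receive the zero decomposition; the ultrafilter ignores them.
  have hex : ∀ X : TensorSpace, ∃ (a : Fin 9 → Module.Dual ℂ C3)
      (b : Fin 9 → SchurModule shape21 (Module.Dual ℂ C3)) (c : Fin 9 → SchurModule shape22 C3),
      X ∈ rankLE (Module.Dual ℂ C3) (SchurModule shape21 (Module.Dual ℂ C3))
        (SchurModule shape22 C3) 9 → X = ∑ r, a r ⊗ₜ[ℂ] (b r ⊗ₜ[ℂ] c r) := by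
    intro X
    by_cases hX : X ∈ rankLE (Module.Dual ℂ C3) (SchurModule shape21 (Module.Dual ℂ C3))
        (SchurModule shape22 C3) 9
    · obtain ⟨a, b, c, h⟩ := hX
      exact ⟨a, b, c, fun _ => h⟩
    · exact ⟨0, 0, 0, fun h => absurd h hX⟩
  choose a b c habc using hex
  refine not_tendsto_invariantCoord 𝒰 (fun X r => dualCoord (a X r))
    (fun X r i j => schurCoord21 (b X r) (i, j)) (fun X r k l => schurCoord22 (c X r) (k, l))
    fun p i j k l => ?_
  have hcont : Continuous spaceCoord := spaceCoord.continuous_moduleTopology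
  have hlim : Tendsto (fun X => spaceCoord X (p, (i, j), (k, l))) 𝒰
      (𝓝 (spaceCoord T (p, (i, j), (k, l)))) :=
    (((continuous_apply (p, (i, j), (k, l))).comp hcont).tendsto T).mono_left hle
  rw [hT] at hlim
  refine hlim.congr' ?_
  filter_upwards [h𝒰] with X hX
  conv_lhs => rw [habc X hX]
  simp only [map_sum, Finset.sum_apply, spaceCoord, coordMap_tmul]

end InvariantTensor

end

theorem mainTheorem2 :
    -- the three factors have dimensions 3, 8, 6
    (Module.finrank ℂ (Module.Dual ℂ C3) = 3 ∧
      Module.finrank ℂ (SchurModule shape21 (Module.Dual ℂ C3)) = 8 ∧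
      Module.finrank ℂ (SchurModule shape22 C3) = 6) ∧
    -- there is a nonzero invariant tensor, unique up to scalars; its border rank is 10,
    -- and no tensor in the space has larger border rank
    ∃ T : TensorSpace, T ≠ 0 ∧ tensorRep.invariants = Submodule.span ℂ {T} ∧
      borderRank T = 10 ∧ ∀ T' : TensorSpace, borderRank T' ≤ 10 := by
  have hA : Module.finrank ℂ (Module.Dual ℂ C3) = 3 := by
    rw [Subspace.dual_finrank_eq]
    exact Module.finrank_fin_fun ℂ
  have hB := finrank_schurModule21 dualBasisC3
  have hC := finrank_schurModule22 (Pi.basisFun ℂ (Fin 3))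
  have hle : ∀ T' : TensorSpace, T' ∈ borderRankLE (Module.Dual ℂ C3)
      (SchurModule shape21 (Module.Dual ℂ C3)) (SchurModule shape22 C3) 10 := fun T' => by
    rw [borderRankLE_ten_eq_univ hA hB hC]
    exact Set.mem_univ T'
  obtain ⟨T, hT⟩ := exists_spaceCoord_eq
  refine ⟨⟨hA, hB, hC⟩, T, ?_, invariants_eq_span hT, le_antisymm (Nat.sInf_le (hle T)) ?_,
    fun T' => Nat.sInf_le (hle T')⟩
  · rintro rfl
    have := congrFun hT (0, (1, 2), (1, 1))
    rw [map_zero] at this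
    simp [invariantVec, invariantCoord, leviCivita] at this
    norm_num at this
  -- Any r < 10 admitting T would, by monotonicity, put T in the closure for nine terms.
  · refine le_csInf ⟨10, hle T⟩ fun r hr => ?_
    by_contra! hlt
    exact notMem_borderRankLE_nine hT (borderRankLE_mono (Nat.le_of_lt_succ hlt) hr)
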